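/- Let $\mathcal D$ be a family of probability distributions on $\mathbb Z$ and let $\gamma\in(0,1)$, $L>0$, $B>0$ be such that: 1. every $D\in\mathcal D$ is unimodal (there is $M\in\mathbb Z$ such that $D(x)\ge D(x+1)$ for all $x\ge M$ and $D(x)\le D(x+1)$ for all $x<M$), and every mode of $D$ (every point maximizing $x\mapsto D(x)$) has probability at most $1-\gamma$; 2. all modes of all distributions in $\mathcal D$ lie in one common interval of length $L$; 3. every $D\in\mathcal D$ has a finite fourth moment, and $\mathbf E_{W\sim D}\left[|W-\mathbf E[W]|^4\right]\le B$. For $n\in\mathbb N$, a $\mathcal D$-SIIRV of order $n$ is a random variable of the form $X=\sum_{i=1}^{n'}X_i$ with $n'\le n$ and independent $X_i\sim D_i\in\mathcal D$. A discretized Gaussian is the distribution of a normal random variable of positive variance rounded to the nearest integer. The total variation distance is $d_{TV}(P,Q)=\frac12\sum_{x\in\mathbb Z}|P(x)-Q(x)|$. **Theorem (Structure of SIIURVs).** There is a universal polynomial $p$ in three variables such that, for all $n$, $\gamma$, $L$, $B$, $\mathcal D$ as above and all $\epsilon>0$, there is a set $\mathcal C$ of at most $\max(L,2)^{p(B,1/\gamma,1/\epsilon)}$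 probability distributions on $\mathbb Z$ such that for every $\mathcal D$-SIIRV $X$ of order $n$ there is an integer-valued random variable $Y$ with $d_{TV}(X,Y)\le\epsilon$ and either (i) the distribution of $Y$ belongs to $\mathcal C$ (sparse form), or (ii) $Y$ is a discretized Gaussian with $\mathbf E[Y]=\mathbf E[X]$ and $\mathbf{Var}(Y)=\mathbf{Var}(X)$ (dense form). -/

import Mathlib

open MeasureTheory ProbabilityTheory
open scoped NNReal

noncomputable section

/-- Total variation distance of two probability measures on `ℤ`: half the `ℓ¹` distance of the
probability mass functions. -/
def tvDist (μ ν : Measure ℤ) : ℝ := (1 / 2) * ∑' x : ℤ, |μ.real {x} - ν.real {x}|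

/-- `M` is a mode of `μ`: a point of maximal probability mass. -/
def IsMode (μ : Measure ℤ) (M : ℤ) : Prop := ∀ x : ℤ, μ.real {x} ≤ μ.real {M}

/-- `μ` is unimodal: the probability mass function is nondecreasing up to some integer `M` and
nonincreasing from `M` on. -/
def IsUnimodal (μ : Measure ℤ) : Prop :=
  ∃ M : ℤ, (∀ x : ℤ, M ≤ x → μ.real {x + 1} ≤ μ.real {x}) ∧
    (∀ x : ℤ, x < M → μ.real {x} ≤ μ.real {x + 1})

/-- The assumptions on the family `D` of distributions over `ℤ`, with parameters `γ`, `L`, `B`. -/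
structure UnimodalBoundedFamily (D : Set (ProbabilityMeasure ℤ)) (γ L B : ℝ) : Prop where
  /-- Every member of the family is unimodal. -/
  unimodal : ∀ ν ∈ D, IsUnimodal ν
  /-- The modes have probability at most `1 - γ`. -/
  mode_mass_le : ∀ ν ∈ D, ∀ M : ℤ, IsMode ν M → (ν : Measure ℤ).real {M} ≤ 1 - γ
  /-- All the modes of all the members lie in one interval of length `L`. -/
  mode_mem : ∃ a : ℝ, ∀ ν ∈ D, ∀ M : ℤ, IsMode ν M → (M : ℝ) ∈ Set.Icc a (a + L)
  /-- The fourth moments exist. -/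
  memLp_four : ∀ ν ∈ D, MemLp (fun x : ℤ => (x : ℝ)) 4 (ν : Measure ℤ)
  /-- The fourth central moments are at most `B`. -/
  centralMoment_four_le : ∀ ν ∈ D, centralMoment (fun x : ℤ => (x : ℝ)) 4 (ν : Measure ℤ) ≤ B

/-- `X` is a `D`-SIIRV of order `n`: a sum of at most `n` independent integer random variables, each
with distribution in `D`. -/
def IsSIIRV (D : Set (ProbabilityMeasure ℤ)) (n : ℕ) {Ω : Type*} [MeasurableSpace Ω]
    (P : Measure Ω) (X : Ω → ℤ) : Prop :=
  ∃ n' ≤ n, ∃ ξ : Fin n' → Ω → ℤ,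
    (∀ i, Measurable (ξ i)) ∧ iIndepFun ξ P ∧
    (∀ i, ∃ ν ∈ D, P.map (ξ i) = (ν : Measure ℤ)) ∧
    ∀ ω, X ω = ∑ i, ξ i ω

/-- The discretized Gaussian: the law of a normal random variable with parameters `m`, `v` rounded
to the nearest integer, so that `z` has the mass that the normal law gives to
`[z - 1/2, z + 1/2)`. -/
def discretizedGaussian (m : ℝ) (v : ℝ≥0) : Measure ℤ :=
  (gaussianReal m v).map (fun x : ℝ => ⌊x + 1 / 2⌋)

instance (m : ℝ) (v : ℝ≥0) : IsProbabilityMeasure (discretizedGaussian m v) :=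
  Measure.isProbabilityMeasure_map
    (Int.measurable_floor.comp (measurable_id.add_const (1 / 2 : ℝ))).aemeasurable

end

/-!
The number of summands decides between the two forms. Let `q` be an integer exceeding `1 + B`,
`1 / γ` and `1 / ε`, and let `K = 60000² q¹²`.

**Many summands.** A sum of at least `K` summands is in dense form, by a quantitative local limit
theorem. Unimodality enters through the overlap of a law with its translate by one, which has total
mass one minus the mass of the mode, hence at least `γ`. A law is therefore a mixture, of weight `γ`
at least, of uniform laws on pairs `{x, x + 1}` and of another law, so that its characteristic
function is at most `1 - γ (1 - cos (t / 2)) ≤ exp (-γ t² / 20)` on `[-π, π]`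
(`IsUnimodal.norm_intCharFun_le_exp`). The fourth moment controls the distance from the
characteristic function of a summand to that of the normal law with the same mean and variance by a
multiple of `|t|³` (`norm_intCharFun_sub_gaussian_le`). Telescoping the product over the summands and
integrating, Fourier inversion bounds the pointwise distance to a normal density by `O(1 / n)`
(`local_limit_gaussianPDFReal`), uniformly under changes of the centre by at most `1` and of the
variance by the order of its square root. The first freedom also covers the averaging of the density
over unit intervals, that is, discretization (`local_limit_discretizedGaussian`); both are needed
since the discretized Gaussian with the mean and variance of the sum comes from a normal law with
slightly different parameters. That it exists follows from the strict monotonicity of the mean in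
the centre and from the intermediate value theorem (`exists_discretizedGaussian_mean_variance_eq`).
Chebyshev's inequality on a window of width of order `√n` then turns the pointwise bound `O(1 / n)`
into a total variation bound of order `1 / √n` plus a small constant
(`tvDist_le_of_mean_variance_eq`).

**Few summands.** A sum of fewer than `K` summands has a variance bounded in terms of `q`, and its
mean is within a bounded distance of a sum of modes, because the mean of a unimodal law is near its
mode (`IsUnimodal.exists_isMode_near_mean`). Hence up to a small mass it lives on a window whose
width depends on `q` only, and whose centre takes `O(L)` values. Rounding the masses on the window
gives finitely many classes of small diameter, and one representative of each is kept
(`exists_finset_net`). The number of classes is `max L 2` times an exponential in a polynomial of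
`q`, as required.
-/

/-! ### Fourier inversion -/

/-- The characteristic function of a measure on `ℤ`, as a function on `ℝ`. -/
noncomputable def intCharFun (ρ : Measure ℤ) (t : ℝ) : ℂ :=
  ∫ x : ℤ, Complex.exp (t * x * Complex.I) ∂ρ

theorem charFun_map_intCast (ρ : Measure ℤ) (t : ℝ) :
    charFun (ρ.map (Int.cast : ℤ → ℝ)) t = intCharFun ρ t := by
  rw [charFun_apply_real, integral_map (by fun_prop) (by fun_prop)]
  simp [intCharFun]

theorem integral_exp_intCast_mul (k : ℤ) :
    ∫ t in (-Real.pi)..Real.pi, Complex.exp (t * k * Complex.I) =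
      if k = 0 then 2 * (Real.pi : ℂ) else 0 := by
  split_ifs with h
  · subst h
    simp [two_mul]
  · have hk : (k : ℂ) * Complex.I ≠ 0 := by simp [h]
    have : ∀ t : ℝ, Complex.exp (t * k * Complex.I) = Complex.exp ((k * Complex.I) * t) := by
      intro t; ring_nf
    simp_rw [this]
    rw [integral_exp_mul_complex hk]
    rw [div_eq_zero_iff, sub_eq_zero]
    left
    rw [Complex.exp_eq_exp_iff_exists_int]
    exact ⟨k, by push_cast; ring⟩

theorem norm_exp_mul_I_mul_real (x y : ℝ) : ‖Complex.exp (x * y * Complex.I)‖ = 1 := by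
  rw [← Complex.ofReal_mul, Complex.norm_exp_ofReal_mul_I]

/-- Fourier inversion on `ℤ`. -/
theorem measureReal_singleton_eq_integral (ρ : Measure ℤ) [IsProbabilityMeasure ρ] (z : ℤ) :
    ((ρ.real {z} : ℝ) : ℂ) = (2 * Real.pi : ℂ)⁻¹ *
      ∫ t in (-Real.pi)..Real.pi, intCharFun ρ t * Complex.exp (-(t * z * Complex.I)) := by
  have h1 : ∀ t : ℝ, intCharFun ρ t * Complex.exp (-(t * z * Complex.I)) =
      ∫ x : ℤ, Complex.exp (t * (x - z : ℤ) * Complex.I) ∂ρ := by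
    intro t
    rw [intCharFun, ← integral_mul_const]
    congr 1
    ext x
    rw [← Complex.exp_add]
    push_cast
    ring_nf
  simp_rw [h1]
  rw [intervalIntegral.integral_of_le (by linarith [Real.pi_pos]), integral_integral_swap]
  · simp_rw [← intervalIntegral.integral_of_le (show -Real.pi ≤ Real.pi by linarith [Real.pi_pos]),
      integral_exp_intCast_mul]
    have : (fun x : ℤ => if x - z = 0 then 2 * (Real.pi : ℂ) else 0) =
        Set.indicator {z} (fun _ => 2 * (Real.pi : ℂ)) := by
      ext x
      simp [Set.indicator_apply, sub_eq_zero]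
    rw [this, integral_indicator_const _ (measurableSet_singleton z)]
    have : (2 * Real.pi : ℂ) ≠ 0 := by simp [Real.pi_ne_zero]
    rw [Complex.real_smul]
    field_simp
  · refine Integrable.mono' (g := fun _ => (1 : ℝ)) (integrable_const _) ?_ ?_
    · refine Measurable.aestronglyMeasurable ?_
      fun_prop
    · refine Filter.Eventually.of_forall ?_
      rintro ⟨t, x⟩
      simp only [Function.uncurry]
      have := norm_exp_mul_I_mul_real t ((x - z : ℤ) : ℝ)
      push_cast at this ⊢
      exact this.le

theorem continuous_intCharFun (ρ : Measure ℤ) [IsProbabilityMeasure ρ] :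
    Continuous (intCharFun ρ) := by
  have : IsProbabilityMeasure (ρ.map (Int.cast : ℤ → ℝ)) :=
    Measure.isProbabilityMeasure_map (by fun_prop)
  have h : intCharFun ρ = charFun (ρ.map (Int.cast : ℤ → ℝ)) := by
    ext t; rw [charFun_map_intCast]
  rw [h]
  exact continuous_charFun

/-- Fourier inversion for the normal density. -/
theorem gaussianPDFReal_eq_integral (m : ℝ) {v : ℝ≥0} (hv : 0 < v) (x : ℝ) :
    ((gaussianPDFReal m v x : ℝ) : ℂ) = (2 * Real.pi : ℂ)⁻¹ *
      ∫ t : ℝ, Complex.exp (t * m * Complex.I - v * t ^ 2 / 2) *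
        Complex.exp (-(t * x * Complex.I)) := by
  have hv' : (0 : ℝ) < v := by exact_mod_cast hv
  have h1 : ∀ t : ℝ, Complex.exp (t * m * Complex.I - v * t ^ 2 / 2) *
        Complex.exp (-(t * x * Complex.I)) =
      Complex.exp ((-(v / 2) : ℂ) * t ^ 2 + ((m - x) * Complex.I) * t + 0) := by
    intro t
    rw [← Complex.exp_add]
    ring_nf
  simp_rw [h1]
  have hre : (-(v / 2) : ℂ).re < 0 := by
    have : (-(v / 2) : ℂ) = ((-(v / 2) : ℝ) : ℂ) := by push_cast; rfl
    rw [this, Complex.ofReal_re]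
    linarith
  rw [integral_cexp_quadratic hre]
  have h2 : ((Real.pi : ℂ) / -(-(v / 2))) ^ (1 / 2 : ℂ) = ((√(2 * Real.pi / v) : ℝ) : ℂ) := by
    rw [Real.sqrt_eq_rpow, Complex.ofReal_cpow (by positivity)]
    congr 1
    · push_cast
      field_simp
    · simp
  have h3 : (0 - ((m - x) * Complex.I) ^ 2 / (4 * (-(v / 2))) : ℂ) =
      ((-(x - m) ^ 2 / (2 * v) : ℝ) : ℂ) := by
    have : (v : ℂ) ≠ 0 := by exact_mod_cast hv.ne'
    rw [mul_pow, Complex.I_sq]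
    push_cast
    field_simp
    ring
  rw [h2, h3, gaussianPDFReal]
  rw [← Complex.ofReal_exp]
  norm_cast
  rw [← mul_assoc]
  congr 1
  rw [Real.sqrt_div (by positivity), Real.sqrt_mul (by positivity)]
  have hp := Real.mul_self_sqrt (show 0 ≤ 2 * Real.pi by positivity)
  have : 0 < √(2 * Real.pi) := Real.sqrt_pos.2 (by positivity)
  have : 0 < √(v : ℝ) := Real.sqrt_pos.2 hv'
  field_simp
  nlinarith

theorem integrable_abs_pow_mul_exp_neg_mul_sq (j : ℕ) {k : ℝ} (hk : 0 < k) :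
    Integrable fun t : ℝ => |t| ^ j * Real.exp (-k * t ^ 2) := by
  have h := (integrable_rpow_mul_exp_neg_mul_sq hk (s := j)
    (by linarith [Nat.cast_nonneg (α := ℝ) j])).norm
  refine h.congr (Filter.Eventually.of_forall fun t => ?_)
  simp [Real.rpow_natCast]

theorem integral_abs_pow_mul_exp_neg_mul_sq (j : ℕ) {k : ℝ} (hk : 0 < k) :
    ∫ t : ℝ, |t| ^ j * Real.exp (-k * t ^ 2) =
      k ^ (-((j : ℝ) + 1) / 2) * Real.Gamma ((j + 1) / 2) := by
  have h := integral_comp_abs (f := fun t : ℝ => t ^ j * Real.exp (-k * t ^ 2))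
  simp only [sq_abs] at h
  have h' := integral_rpow_mul_exp_neg_mul_rpow (p := 2) (q := j) (by norm_num)
    (by linarith [Nat.cast_nonneg (α := ℝ) j]) hk
  rw [h]
  norm_cast at h' ⊢
  rw [h']
  push_cast
  ring

theorem integral_abs_mul_exp_neg_mul_sq {k : ℝ} (hk : 0 < k) :
    ∫ t : ℝ, |t| * Real.exp (-k * t ^ 2) = 1 / k := by
  have := integral_abs_pow_mul_exp_neg_mul_sq 1 hk
  norm_num [Real.rpow_neg_one] at this ⊢
  exact this

theorem integral_abs_cube_mul_exp_neg_mul_sq {k : ℝ} (hk : 0 < k) :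
    ∫ t : ℝ, |t| ^ 3 * Real.exp (-k * t ^ 2) = 1 / k ^ 2 := by
  have := integral_abs_pow_mul_exp_neg_mul_sq 3 hk
  norm_num at this ⊢
  exact this

/-! ### The characteristic function of a unimodal law, moments, and Taylor expansion -/

theorem hasSum_measureReal_singleton (ρ : Measure ℤ) [IsProbabilityMeasure ρ] :
    HasSum (fun x : ℤ => ρ.real {x}) 1 := by
  have h := hasSum_integral_measure (μ := fun x : ℤ => ρ {x} • Measure.dirac x)
    (f := fun _ : ℤ => (1 : ℝ)) (by rw [Measure.sum_smul_dirac]; exact integrable_const _)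
  rw [Measure.sum_smul_dirac] at h
  simpa [measureReal_def] using h

theorem intCharFun_eq_tsum (ρ : Measure ℤ) [IsProbabilityMeasure ρ] (t : ℝ) :
    intCharFun ρ t = ∑' x : ℤ, ((ρ.real {x} : ℝ) : ℂ) * Complex.exp (t * x * Complex.I) := by
  rw [intCharFun, integral_countable]
  · simp [Complex.real_smul]
  · refine (integrable_const (1 : ℝ)).mono' (by fun_prop) (Filter.Eventually.of_forall fun x => ?_)
    have := norm_exp_mul_I_mul_real t x
    push_cast at this
    exact this.le

theorem norm_one_add_exp_mul_I {t : ℝ} (ht : |t| ≤ Real.pi) :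
    ‖(1 + Complex.exp (t * Complex.I)) / 2‖ = Real.cos (t / 2) := by
  have hc : 0 ≤ Real.cos (t / 2) := by
    rw [abs_le] at ht
    exact Real.cos_nonneg_of_mem_Icc ⟨by linarith, by linarith⟩
  have h : (1 + Complex.exp (t * Complex.I)) / 2 =
      Complex.exp ((t / 2 : ℝ) * Complex.I) * ((Real.cos (t / 2) : ℝ) : ℂ) := by
    rw [Complex.ofReal_cos, Complex.cos]
    have : Complex.exp (t * Complex.I) =
        Complex.exp ((t / 2 : ℝ) * Complex.I) * Complex.exp ((t / 2 : ℝ) * Complex.I) := by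
      rw [← Complex.exp_add]; push_cast; ring_nf
    rw [this]
    have h2 : Complex.exp ((t / 2 : ℝ) * Complex.I) * Complex.exp (-(t / 2 : ℝ) * Complex.I) = 1 := by
      rw [← Complex.exp_add]; simp
    linear_combination -(1 / 2) * h2
  rw [h, norm_mul, Complex.norm_exp_ofReal_mul_I, one_mul, Complex.norm_real, Real.norm_eq_abs,
    abs_of_nonneg hc]

theorem IsUnimodal.exists_isMode {ρ : Measure ℤ} (h : IsUnimodal ρ) :
    ∃ M : ℤ, IsMode ρ M ∧ (∀ x : ℤ, M ≤ x → ρ.real {x + 1} ≤ ρ.real {x}) ∧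
      (∀ x : ℤ, x < M → ρ.real {x} ≤ ρ.real {x + 1}) := by
  obtain ⟨M, h1, h2⟩ := h
  refine ⟨M, fun x => ?_, h1, h2⟩
  rcases le_total M x with hx | hx
  · induction x, hx using Int.leInduction with
    | base => exact le_rfl
    | succ n hn ih => exact (h1 n hn).trans ih
  · induction x, hx using Int.leInductionDown with
    | base => exact le_rfl
    | pred n hn ih =>
      have := h2 (n - 1) (by omega)
      rw [sub_add_cancel] at this
      exact this.trans ih

/-- The overlap `m` of a unimodal law with its translate by one has total mass one minus the mass of
the mode. -/
theorem exists_overlap {d : ℤ → ℝ} (hd0 : ∀ x, 0 ≤ d x) (hds : HasSum d 1) {M : ℤ}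
    (hdown : ∀ x : ℤ, M ≤ x → d (x + 1) ≤ d x) (hup : ∀ x : ℤ, x < M → d x ≤ d (x + 1)) :
    ∃ m : ℤ → ℝ, (∀ x, 0 ≤ m x) ∧ (∀ x, m x ≤ d x) ∧ (∀ x, m (x - 1) ≤ d x) ∧
      HasSum m (1 - d M) := by
  refine ⟨fun x => if x < M then d x else d (x + 1), fun x => ?_, fun x => ?_, fun x => ?_, ?_⟩
  · dsimp only
    split_ifs <;> exact hd0 _
  · dsimp only
    split_ifs with hx
    · exact le_rfl
    · exact hdown x (by omega)
  · dsimp only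
    split_ifs with hx
    · have := hup (x - 1) hx
      rwa [sub_add_cancel] at this
    · rw [sub_add_cancel]
  have hf : Summable (fun x => if x < M then d x else 0) :=
    Summable.of_nonneg_of_le (fun x => by split_ifs <;> simp [hd0])
      (fun x => by split_ifs <;> simp [hd0]) hds.summable
  have hg : Summable (fun x => if M < x then d x else 0) :=
    Summable.of_nonneg_of_le (fun x => by split_ifs <;> simp [hd0])
      (fun x => by split_ifs <;> simp [hd0]) hds.summable
  have hg' := (Equiv.addRight (1 : ℤ)).hasSum_iff.2 hg.hasSum
  have hfg := (hf.hasSum.add hg.hasSum).add (hasSum_ite_eq M (d M))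
  have hfg' : (fun x => (if x < M then d x else 0) + (if M < x then d x else 0) +
      if x = M then d M else 0) = d := by
    funext x
    rcases lt_trichotomy x M with hx | hx | hx
    · simp [hx, hx.ne, hx.le]
    · simp [hx]
    · simp [hx, hx.ne', hx.le]
  rw [hfg'] at hfg
  have heq := hfg.unique hds
  have hmm : (fun x => if x < M then d x else d (x + 1)) = fun x => (if x < M then d x else 0) +
      ((fun x => if M < x then d x else 0) ∘ Equiv.addRight (1 : ℤ)) x := by
    funext x
    simp only [Function.comp, Equiv.coe_addRight]
    by_cases hx : x < M
    · have : ¬ M < x + 1 := by omega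
      simp [hx, this]
    · have : M < x + 1 := by omega
      simp [hx, this]
  rw [hmm, ← heq, add_sub_cancel_right]
  exact hf.hasSum.add hg'

/-- Half of the overlap `m` at `x - 1` and half of it at `x` are both carried by the mass at `x`. Splitting
them off writes `ρ` as the sum of a part of mass `1 - s` and of `m` convolved with the uniform law on
`{0, 1}`, whose characteristic function has modulus `cos (t / 2)`. -/
theorem norm_intCharFun_le_of_overlap {ρ : Measure ℤ} [IsProbabilityMeasure ρ] {m : ℤ → ℝ} {s : ℝ}
    (hm0 : ∀ x, 0 ≤ m x) (hm1 : ∀ x, m x ≤ ρ.real {x}) (hm2 : ∀ x, m (x - 1) ≤ ρ.real {x})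
    (hmsum : HasSum m s) {t : ℝ} (ht : |t| ≤ Real.pi) :
    ‖intCharFun ρ t‖ ≤ 1 - s * (1 - Real.cos (t / 2)) := by
  have hds : HasSum (fun x => ρ.real {x}) 1 := hasSum_measureReal_singleton ρ
  set e : ℤ → ℂ := fun x => Complex.exp (t * x * Complex.I) with he
  have hen : ∀ x, ‖e x‖ = 1 := fun x => by
    have := norm_exp_mul_I_mul_real t x
    push_cast at this
    exact this
  have hme : Summable fun x => (m x : ℂ) * e x := by
    refine Summable.of_norm ?_
    simpa [hen, abs_of_nonneg (hm0 _)] using hmsum.summable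
  set A : ℂ := ∑' x, (m x : ℂ) * e x with hA
  have hmshift : HasSum (fun x => ((m (x - 1) : ℝ) : ℂ) * e x)
      (Complex.exp (t * Complex.I) * A) := by
    rw [← (Equiv.addRight (1 : ℤ)).hasSum_iff]
    have heq : (fun x => ((m (x - 1) : ℝ) : ℂ) * e x) ∘ (Equiv.addRight (1 : ℤ)) =
        fun x => Complex.exp (t * Complex.I) * ((m x : ℂ) * e x) := by
      funext x
      simp only [he, Function.comp, Equiv.coe_addRight, add_sub_cancel_right]
      rw [mul_left_comm, ← Complex.exp_add]
      push_cast
      ring_nf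
    rw [heq]
    exact hme.hasSum.mul_left _
  set r : ℤ → ℝ := fun x => ρ.real {x} - (m x + m (x - 1)) / 2 with hr
  have hr0 : ∀ x, 0 ≤ r x := fun x => by simp only [hr]; linarith [hm1 x, hm2 x]
  have hmsum' : HasSum (fun x => m (x - 1)) s :=
    (Equiv.subRight (1 : ℤ)).hasSum_iff.2 hmsum
  have hrsum : HasSum r (1 - s) := by
    have h := hds.sub ((hmsum.add hmsum').div_const 2)
    rwa [add_self_div_two] at h
  have hre : Summable fun x => (r x : ℂ) * e x := by
    refine Summable.of_norm ?_
    simpa [hen, abs_of_nonneg (hr0 _)] using hrsum.summable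
  have hphi : intCharFun ρ t = (∑' x, (r x : ℂ) * e x) +
      (1 + Complex.exp (t * Complex.I)) / 2 * A := by
    rw [intCharFun_eq_tsum]
    have h := hre.hasSum.add ((hme.hasSum.add hmshift).div_const 2)
    have h2 : (fun x => (r x : ℂ) * e x + ((m x : ℂ) * e x + ((m (x - 1) : ℝ) : ℂ) * e x) / 2) =
        fun x : ℤ => ((ρ.real {x} : ℝ) : ℂ) * Complex.exp (t * x * Complex.I) := by
      funext x
      simp only [hr, he]
      push_cast
      ring
    rw [h2] at h
    rw [h.tsum_eq]
    ring
  have hn1 : ‖∑' x, (r x : ℂ) * e x‖ ≤ 1 - s := by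
    refine tsum_of_norm_bounded hrsum fun x => ?_
    simp [hen, abs_of_nonneg (hr0 _)]
  have hn2 : ‖A‖ ≤ s := by
    refine tsum_of_norm_bounded hmsum fun x => ?_
    simp [hen, abs_of_nonneg (hm0 _)]
  have hcos : 0 ≤ Real.cos (t / 2) := by
    rw [← norm_one_add_exp_mul_I ht]; positivity
  calc ‖intCharFun ρ t‖ ≤ 1 - s + Real.cos (t / 2) * s := by
        rw [hphi]
        refine (norm_add_le _ _).trans (add_le_add hn1 ?_)
        rw [norm_mul, norm_one_add_exp_mul_I ht]
        exact mul_le_mul_of_nonneg_left hn2 hcos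
    _ = 1 - s * (1 - Real.cos (t / 2)) := by ring

theorem IsUnimodal.norm_intCharFun_le_one_sub {ρ : Measure ℤ} [IsProbabilityMeasure ρ] {γ : ℝ}
    (h : IsUnimodal ρ) (hγ : ∀ M, IsMode ρ M → ρ.real {M} ≤ 1 - γ) {t : ℝ} (ht : |t| ≤ Real.pi) :
    ‖intCharFun ρ t‖ ≤ 1 - γ * (1 - Real.cos (t / 2)) := by
  obtain ⟨M, hmode, hdown, hup⟩ := h.exists_isMode
  obtain ⟨m, hm0, hm1, hm2, hms⟩ := exists_overlap (fun x => measureReal_nonneg)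
    (hasSum_measureReal_singleton ρ) hdown hup
  refine (norm_intCharFun_le_of_overlap hm0 hm1 hm2 hms ht).trans ?_
  nlinarith [Real.cos_le_one (t / 2), hγ M hmode]

theorem IsUnimodal.norm_intCharFun_le_exp {ρ : Measure ℤ} [IsProbabilityMeasure ρ] {γ : ℝ}
    (hγ0 : 0 < γ)
    (h : IsUnimodal ρ) (hγ : ∀ M, IsMode ρ M → ρ.real {M} ≤ 1 - γ) {t : ℝ} (ht : |t| ≤ Real.pi) :
    ‖intCharFun ρ t‖ ≤ Real.exp (-(γ / 20 * t ^ 2)) := by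
  refine (h.norm_intCharFun_le_one_sub hγ ht).trans ?_
  have h1 := Real.cos_le_one_sub_mul_cos_sq (x := t / 2) (by
    rw [abs_div, abs_two]; linarith [Real.pi_pos])
  have h2 : 1 / 20 * t ^ 2 ≤ 2 / Real.pi ^ 2 * (t / 2) ^ 2 := by
    have : Real.pi ^ 2 ≤ 10 := by nlinarith [Real.pi_lt_d2, Real.pi_pos]
    have : 1 / 10 ≤ 1 / Real.pi ^ 2 := one_div_le_one_div_of_le (by positivity) this
    have h3 : 2 / Real.pi ^ 2 * (t / 2) ^ 2 = 1 / Real.pi ^ 2 * (t ^ 2 / 2) := by ring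
    rw [h3]
    nlinarith [sq_nonneg t]
  have h4 : 1 - γ * (1 - Real.cos (t / 2)) ≤ -(γ / 20 * t ^ 2) + 1 := by nlinarith
  exact h4.trans (Real.add_one_le_exp _)

theorem norm_exp_mul_I_sub_taylor_le (y : ℝ) :
    ‖Complex.exp (y * Complex.I) - (1 + y * Complex.I - y ^ 2 / 2)‖ ≤ 4 * |y| ^ 3 := by
  rcases le_or_gt |y| 1 with hy | hy
  · have h := Complex.norm_exp_sub_sum_le_norm_mul_exp (y * Complex.I) 3
    have hs : ∑ m ∈ Finset.range 3, ((y : ℂ) * Complex.I) ^ m / (m.factorial : ℂ) =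
        1 + y * Complex.I - y ^ 2 / 2 := by
      simp [Finset.sum_range_succ, Nat.factorial, mul_pow, Complex.I_sq]
      ring
    rw [hs] at h
    have hn : ‖(y : ℂ) * Complex.I‖ = |y| := by simp
    rw [hn] at h
    refine h.trans ?_
    have : Real.exp |y| ≤ 4 := (Real.exp_le_exp.2 hy).trans (by linarith [Real.exp_one_lt_d9])
    nlinarith [pow_nonneg (abs_nonneg y) 3]
  · have h1 : ‖(1 : ℂ) + y * Complex.I - y ^ 2 / 2‖ ≤ 1 + |y| + |y| ^ 2 / 2 := by
      refine (norm_sub_le _ _).trans (add_le_add ((norm_add_le _ _).trans ?_) ?_) <;> simp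
    refine (norm_sub_le _ _).trans ?_
    rw [Complex.norm_exp_ofReal_mul_I]
    have h2 : |y| ≤ |y| ^ 2 := by nlinarith
    have h3 : |y| ^ 2 ≤ |y| ^ 3 := by nlinarith [sq_nonneg |y|]
    nlinarith

theorem abs_exp_neg_sub_le {y : ℝ} (hy : 0 ≤ y) : |Real.exp (-y) - (1 - y)| ≤ y ^ 2 := by
  rw [abs_of_nonneg (by linarith [Real.add_one_le_exp (-y)])]
  rcases le_or_gt y 1 with h | h
  · have := Real.abs_exp_sub_one_sub_id_le (x := -y) (by rwa [abs_neg, abs_of_nonneg hy])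
    rw [abs_le] at this
    linarith [this.2, neg_sq y]
  · have : Real.exp (-y) ≤ 1 := Real.exp_le_one_iff.2 (by linarith)
    nlinarith

theorem memLp_sub_const_of_memLp_four {ρ : Measure ℤ} [IsProbabilityMeasure ρ]
    (h4 : MemLp (fun x : ℤ => (x : ℝ)) 4 ρ) (a : ℝ) : MemLp (fun x : ℤ => (x : ℝ) - a) 4 ρ :=
  h4.sub (memLp_const a)

theorem integrable_sub_pow {ρ : Measure ℤ} [IsProbabilityMeasure ρ]
    (h4 : MemLp (fun x : ℤ => (x : ℝ)) 4 ρ) (a : ℝ) {j : ℕ} (hj : j ≤ 4) :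
    Integrable (fun x : ℤ => ((x : ℝ) - a) ^ j) ρ := by
  have h : MemLp (fun x : ℤ => (x : ℝ) - a) j ρ :=
    (memLp_sub_const_of_memLp_four h4 a).mono_exponent (by exact_mod_cast hj)
  rcases Nat.eq_zero_or_pos j with rfl | hj0
  · simp
  · refine (h.integrable_norm_pow hj0.ne').mono (by fun_prop) (Filter.Eventually.of_forall ?_)
    intro x
    simp

theorem centralMoment_four_eq (ρ : Measure ℤ) :
    centralMoment (fun x : ℤ => (x : ℝ)) 4 ρ = ∫ x : ℤ, ((x : ℝ) - ∫ y : ℤ, (y : ℝ) ∂ρ) ^ 4 ∂ρ := by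
  simp [centralMoment]

theorem variance_le_one_add {ρ : Measure ℤ} [IsProbabilityMeasure ρ]
    (h4 : MemLp (fun x : ℤ => (x : ℝ)) 4 ρ) {B : ℝ} (hB : centralMoment (fun x : ℤ => (x : ℝ)) 4 ρ ≤ B) :
    variance (fun x : ℤ => (x : ℝ)) ρ ≤ 1 + B := by
  rw [centralMoment_four_eq ρ] at hB
  rw [variance_eq_integral (by fun_prop)]
  set a := ∫ y : ℤ, (y : ℝ) ∂ρ
  calc ∫ x : ℤ, ((x : ℝ) - a) ^ 2 ∂ρ ≤ ∫ x : ℤ, (1 + ((x : ℝ) - a) ^ 4) ∂ρ := by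
        refine integral_mono (integrable_sub_pow h4 a (by norm_num))
          ((integrable_const _).add (integrable_sub_pow h4 a le_rfl)) fun x => ?_
        nlinarith [sq_nonneg (((x : ℝ) - a) ^ 2 - 1), sq_nonneg ((x : ℝ) - a)]
    _ ≤ 1 + B := by
        rw [integral_add (integrable_const _) (integrable_sub_pow h4 a le_rfl)]
        simpa using hB

/-- On `[-π, π]` the characteristic functions of a law and of the normal law with the same mean and
variance differ by a cubic term. -/
theorem norm_intCharFun_sub_gaussian_le {ρ : Measure ℤ} [IsProbabilityMeasure ρ]
    (h4 : MemLp (fun x : ℤ => (x : ℝ)) 4 ρ) {B : ℝ} (hB0 : 0 ≤ B)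
    (hB : centralMoment (fun x : ℤ => (x : ℝ)) 4 ρ ≤ B) {t : ℝ} (ht : |t| ≤ Real.pi) :
    ‖intCharFun ρ t - Complex.exp (t * (∫ y : ℤ, (y : ℝ) ∂ρ : ℝ) * Complex.I -
      (variance (fun x : ℤ => (x : ℝ)) ρ : ℝ) * t ^ 2 / 2)‖ ≤ 5 * (1 + B) ^ 2 * |t| ^ 3 := by
  have hv1 := variance_le_one_add h4 hB
  have hv0 := variance_nonneg (fun x : ℤ => (x : ℝ)) ρ
  rw [centralMoment_four_eq ρ] at hB
  have hvar : variance (fun x : ℤ => (x : ℝ)) ρ =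
      ∫ x : ℤ, ((x : ℝ) - ∫ y : ℤ, (y : ℝ) ∂ρ) ^ 2 ∂ρ := variance_eq_integral (by fun_prop)
  set v := variance (fun x : ℤ => (x : ℝ)) ρ with hv
  have hint1 := integrable_sub_pow h4 (∫ y : ℤ, (y : ℝ) ∂ρ) (j := 1) (by norm_num)
  have hmean : ∫ x : ℤ, ((x : ℝ) - ∫ y : ℤ, (y : ℝ) ∂ρ) ∂ρ = 0 := by
    have := integrable_sub_pow h4 0 (j := 1) (by norm_num)
    rw [integral_sub (by simpa using this) (integrable_const _)]
    simp
  set a := ∫ y : ℤ, (y : ℝ) ∂ρ with ha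
  have hint2 := integrable_sub_pow h4 a (j := 2) (by norm_num)
  have hint4 := integrable_sub_pow h4 a (j := 4) le_rfl
  have hexp : Integrable (fun x : ℤ => Complex.exp ((t * (x - a) : ℝ) * Complex.I)) ρ := by
    refine (integrable_const (1 : ℝ)).mono' (by fun_prop) (Filter.Eventually.of_forall fun x => ?_)
    rw [Complex.norm_exp_ofReal_mul_I]
  have hphi : intCharFun ρ t = Complex.exp (t * a * Complex.I) *
      ∫ x : ℤ, Complex.exp ((t * (x - a) : ℝ) * Complex.I) ∂ρ := by
    rw [intCharFun, ← integral_const_mul]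
    congr 1
    ext x
    rw [← Complex.exp_add]
    push_cast
    ring_nf
  have hI1 : Integrable (fun x : ℤ => ((t * ((x : ℝ) - a) : ℝ) : ℂ) * Complex.I) ρ := by
    have h : Integrable (fun x : ℤ => t * ((x : ℝ) - a)) ρ := by simpa using hint1.const_mul t
    exact h.ofReal.mul_const _
  have hI2 : Integrable (fun x : ℤ => ((t * ((x : ℝ) - a) : ℝ) : ℂ) ^ 2 / 2) ρ := by
    have h : Integrable (fun x : ℤ => (t * ((x : ℝ) - a)) ^ 2) ρ := by
      simpa [mul_pow] using hint2.const_mul (t ^ 2)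
    simpa using (h.ofReal (𝕜 := ℂ)).div_const 2
  have htay : Integrable (fun x : ℤ => (1 : ℂ) + (t * (x - a) : ℝ) * Complex.I -
      ((t * (x - a) : ℝ) : ℂ) ^ 2 / 2) ρ := by
    exact ((integrable_const _).add hI1).sub hI2
  have htayi : ∫ x : ℤ, ((1 : ℂ) + (t * (x - a) : ℝ) * Complex.I -
      ((t * (x - a) : ℝ) : ℂ) ^ 2 / 2) ∂ρ = ((1 - v * t ^ 2 / 2 : ℝ) : ℂ) := by
    rw [integral_sub, integral_add, integral_mul_const, integral_div]
    · simp_rw [← Complex.ofReal_pow]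
      rw [integral_complex_ofReal, integral_complex_ofReal, integral_const_mul, hmean]
      simp_rw [mul_pow]
      rw [integral_const_mul, ← hvar]
      push_cast
      simp
      ring
    · exact integrable_const _
    · exact hI1
    · exact (integrable_const _).add hI1
    · exact hI2
  have h1 : ‖(∫ x : ℤ, Complex.exp ((t * (x - a) : ℝ) * Complex.I) ∂ρ) -
      ((1 - v * t ^ 2 / 2 : ℝ) : ℂ)‖ ≤ 4 * |t| ^ 3 * (1 + B) := by
    rw [← htayi, ← integral_sub hexp htay]
    have hi : Integrable (fun x : ℤ => 4 * |t| ^ 3 * (1 + ((x : ℝ) - a) ^ 4)) ρ :=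
      ((integrable_const _).add hint4).const_mul _
    refine (norm_integral_le_of_norm_le hi (Filter.Eventually.of_forall fun x => ?_)).trans ?_
    · refine (norm_exp_mul_I_sub_taylor_le _).trans ?_
      rw [abs_mul, mul_pow, ← mul_assoc]
      refine mul_le_mul_of_nonneg_left ?_ (by positivity)
      have : ((x : ℝ) - a) ^ 4 = |(x : ℝ) - a| ^ 4 := by
        rw [← abs_pow, abs_of_nonneg (by positivity)]
      rw [this]
      have hz := abs_nonneg ((x : ℝ) - a)
      generalize |(x : ℝ) - a| = y at hz
      rcases le_total y 1 with h | h
      · have := pow_le_one₀ hz h (n := 3)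
        nlinarith [pow_nonneg hz 4]
      · nlinarith [pow_nonneg hz 3]
    · rw [integral_const_mul, integral_add (integrable_const _) hint4]
      refine mul_le_mul_of_nonneg_left ?_ (by positivity)
      simpa using hB
  have h2 : |Real.exp (-(v * t ^ 2 / 2)) - (1 - v * t ^ 2 / 2)| ≤ (1 + B) ^ 2 * |t| ^ 3 := by
    refine (abs_exp_neg_sub_le (by positivity)).trans ?_
    have e : (v * t ^ 2 / 2) ^ 2 = v ^ 2 * (|t| ^ 3 * (|t| / 4)) := by
      have : t ^ 2 = |t| ^ 2 := (sq_abs t).symm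
      rw [this]; ring
    rw [e]
    refine mul_le_mul (by gcongr) ?_ (by positivity) (by positivity)
    have : |t| / 4 ≤ 1 := by linarith [Real.pi_lt_four]
    nlinarith [pow_nonneg (abs_nonneg t) 3]
  have hpsi : Complex.exp (t * a * Complex.I - v * t ^ 2 / 2) = Complex.exp (t * a * Complex.I) *
      ((Real.exp (-(v * t ^ 2 / 2)) : ℝ) : ℂ) := by
    rw [Complex.ofReal_exp, ← Complex.exp_add]
    push_cast
    ring_nf
  rw [hphi, hpsi, ← mul_sub, norm_mul, norm_exp_mul_I_mul_real, one_mul]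
  calc _ ≤ 4 * |t| ^ 3 * (1 + B) + (1 + B) ^ 2 * |t| ^ 3 := by
        have := norm_sub_le ((∫ x : ℤ, Complex.exp ((t * (x - a) : ℝ) * Complex.I) ∂ρ) -
          ((1 - v * t ^ 2 / 2 : ℝ) : ℂ))
          (((Real.exp (-(v * t ^ 2 / 2)) - (1 - v * t ^ 2 / 2) : ℝ)) : ℂ)
        rw [Complex.norm_real, Real.norm_eq_abs] at this
        refine le_trans (le_of_eq ?_) (this.trans (add_le_add h1 h2))
        congr 1
        push_cast
        ring
    _ ≤ 5 * (1 + B) ^ 2 * |t| ^ 3 := by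
        have : 0 ≤ |t| ^ 3 := by positivity
        nlinarith [mul_nonneg this hB0, mul_nonneg (mul_nonneg this hB0) hB0]

/-- All integers but the one nearest to the mean are at distance at least `1 / 2` from the mean. -/
theorem le_variance_of_forall_singleton_le {ρ : Measure ℤ} [IsProbabilityMeasure ρ]
    (h4 : MemLp (fun x : ℤ => (x : ℝ)) 4 ρ) {γ : ℝ} (hγ : ∀ x : ℤ, ρ.real {x} ≤ 1 - γ) :
    γ / 4 ≤ variance (fun x : ℤ => (x : ℝ)) ρ := by
  rw [variance_eq_integral (by fun_prop)]
  set a := ∫ y : ℤ, (y : ℝ) ∂ρ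
  have h1 : ∀ x : ℤ, Set.indicator {round a}ᶜ (fun _ => (1 / 4 : ℝ)) x ≤ ((x : ℝ) - a) ^ 2 := by
    intro x
    by_cases hx : x = round a
    · simp [hx, sq_nonneg]
    · rw [Set.indicator_of_mem (by simpa using hx)]
      have h2 : |a - round a| ≤ 1 / 2 := abs_sub_round a
      have h3 : (1 : ℝ) ≤ |(x : ℝ) - round a| := by
        have : 1 ≤ |x - round a| := Int.one_le_abs (sub_ne_zero.2 hx)
        exact_mod_cast this
      have h4 : 1 / 2 ≤ |(x : ℝ) - a| := by
        have := abs_sub_abs_le_abs_sub ((x : ℝ) - round a) (a - round a)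
        rw [sub_sub_sub_cancel_right] at this
        linarith
      rw [← sq_abs]
      nlinarith
  have h2 : ∫ x : ℤ, Set.indicator {round a}ᶜ (fun _ => (1 / 4 : ℝ)) x ∂ρ =
      (1 - ρ.real {round a}) / 4 := by
    rw [integral_indicator_const _ (by measurability), probReal_compl_eq_one_sub (by measurability)]
    simp
    ring
  have h3 := integral_mono ((integrable_const (1 / 4 : ℝ)).indicator (by measurability))
    (integrable_sub_pow h4 a (j := 2) (by norm_num)) h1
  rw [h2] at h3
  linarith [hγ (round a)]

/-! ### The local limit theorem -/

/-- The assumptions made on a single law: unimodality, modes of mass at most `1 - γ`, and fourth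
central moment at most `B`. -/
structure IsAdmissible (ν : Measure ℤ) (γ B : ℝ) : Prop where
  unimodal : IsUnimodal ν
  mode_mass_le : ∀ M : ℤ, IsMode ν M → ν.real {M} ≤ 1 - γ
  memLp_four : MemLp (fun x : ℤ => (x : ℝ)) 4 ν
  centralMoment_four_le : centralMoment (fun x : ℤ => (x : ℝ)) 4 ν ≤ B

theorem IsAdmissible.singleton_le {ν : Measure ℤ} {γ B : ℝ} (h : IsAdmissible ν γ B) (x : ℤ) :
    ν.real {x} ≤ 1 - γ := by
  obtain ⟨M, hM, -, -⟩ := h.unimodal.exists_isMode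
  exact (hM x).trans (h.mode_mass_le M hM)

theorem IsAdmissible.le_variance {ν : Measure ℤ} [IsProbabilityMeasure ν] {γ B : ℝ}
    (h : IsAdmissible ν γ B) : γ / 4 ≤ variance (fun x : ℤ => (x : ℝ)) ν :=
  le_variance_of_forall_singleton_le h.memLp_four h.singleton_le

/-- The telescoping bound for a difference of products. The factor `r` on the left avoids the exponent
`n - 1` on the right. -/
theorem mul_norm_prod_sub_prod_le {n : ℕ} (a b : Fin n → ℂ) {r d : ℝ} (hr : 0 ≤ r)
    (ha : ∀ i, ‖a i‖ ≤ r) (hb : ∀ i, ‖b i‖ ≤ r) (hab : ∀ i, ‖a i - b i‖ ≤ d) :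
    r * ‖∏ i, a i - ∏ i, b i‖ ≤ n * r ^ n * d := by
  induction n with
  | zero => simp
  | succ n ih =>
    have hd : 0 ≤ d := (norm_nonneg _).trans (hab 0)
    have ih' := ih (fun i => a i.succ) (fun i => b i.succ) (fun i => ha _) (fun i => hb _)
      (fun i => hab _)
    have hB : ‖∏ i : Fin n, b i.succ‖ ≤ r ^ n := by
      rw [norm_prod]
      refine (Finset.prod_le_prod (fun i _ => norm_nonneg _) fun i _ => hb _).trans ?_
      simp
    rw [Fin.prod_univ_succ, Fin.prod_univ_succ]
    set A := ∏ i : Fin n, a i.succ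
    set B := ∏ i : Fin n, b i.succ
    have h1 : ‖a 0 * A - b 0 * B‖ ≤ r * ‖A - B‖ + d * r ^ n := by
      have : a 0 * A - b 0 * B = a 0 * (A - B) + (a 0 - b 0) * B := by ring
      rw [this]
      refine (norm_add_le _ _).trans (add_le_add ?_ ?_) <;> rw [norm_mul]
      · exact mul_le_mul_of_nonneg_right (ha 0) (norm_nonneg _)
      · exact mul_le_mul (hab 0) hB (norm_nonneg _) hd
    calc r * ‖a 0 * A - b 0 * B‖ ≤ r * (n * r ^ n * d + d * r ^ n) :=
          mul_le_mul_of_nonneg_left (h1.trans (by linarith)) hr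
      _ = ((n + 1 : ℕ) : ℝ) * r ^ (n + 1) * d := by push_cast; ring

theorem norm_exp_sub_exp_le {z w : ℂ} {c : ℝ} (hz : z.re ≤ c) (hw : w.re ≤ c) :
    ‖Complex.exp z - Complex.exp w‖ ≤ Real.exp c * ‖z - w‖ := by
  refine (convex_halfSpace_re_le c).norm_image_sub_le_of_norm_deriv_le (𝕜 := ℂ)
    (fun x _ => Complex.differentiableAt_exp) (fun x hx => ?_) hw hz
  rw [Complex.deriv_exp, Complex.norm_exp]
  exact Real.exp_le_exp.2 hx

theorem re_gaussian_exponent (t m v : ℝ) :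
    (t * m * Complex.I - v * t ^ 2 / 2 : ℂ).re = -(v / 2 * t ^ 2) := by
  have : (t * m * Complex.I - v * t ^ 2 / 2 : ℂ) =
      ((t * m : ℝ) : ℂ) * Complex.I - ((v / 2 * t ^ 2 : ℝ) : ℂ) := by push_cast; ring
  rw [this, Complex.sub_re, Complex.ofReal_re, Complex.re_ofReal_mul]
  simp

theorem norm_gaussian_charFun (t m v : ℝ) :
    ‖Complex.exp (t * m * Complex.I - v * t ^ 2 / 2)‖ = Real.exp (-(v / 2 * t ^ 2)) := by
  rw [Complex.norm_exp, re_gaussian_exponent]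

/-- The telescoping bound costs one factor `exp (-γ t² / 20)`, which is at least `1 / 2` on `[-π, π]`. -/
theorem norm_prod_intCharFun_sub_gaussian_le {n : ℕ} {ν : Fin n → Measure ℤ}
    [∀ i, IsProbabilityMeasure (ν i)] {γ B : ℝ} (hγ0 : 0 < γ) (hγ1 : γ < 1) (hB : 0 ≤ B)
    (hν : ∀ i, IsAdmissible (ν i) γ B) {t : ℝ} (ht : |t| ≤ Real.pi) :
    ‖∏ i, intCharFun (ν i) t - Complex.exp (t * (∑ i, ∫ y : ℤ, (y : ℝ) ∂(ν i) : ℝ) * Complex.I -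
      (∑ i, variance (fun x : ℤ => (x : ℝ)) (ν i) : ℝ) * t ^ 2 / 2)‖ ≤
      10 * n * (1 + B) ^ 2 * (|t| ^ 3 * Real.exp (-(n * γ / 20 * t ^ 2))) := by
  have hprod : Complex.exp (t * (∑ i, ∫ y : ℤ, (y : ℝ) ∂(ν i) : ℝ) * Complex.I -
      (∑ i, variance (fun x : ℤ => (x : ℝ)) (ν i) : ℝ) * t ^ 2 / 2) =
      ∏ i, Complex.exp (t * (∫ y : ℤ, (y : ℝ) ∂(ν i) : ℝ) * Complex.I -
        (variance (fun x : ℤ => (x : ℝ)) (ν i) : ℝ) * t ^ 2 / 2) := by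
    rw [← Complex.exp_sum, Finset.sum_sub_distrib, ← Finset.sum_mul, ← Finset.mul_sum,
      ← Finset.sum_div, ← Finset.sum_mul]
    push_cast
    rfl
  rw [hprod]
  set r := Real.exp (-(γ / 20 * t ^ 2)) with hr
  have hr2 : 1 / 2 ≤ r := by
    have h1 : t ^ 2 ≤ 10 := by
      rw [← sq_abs]
      nlinarith [Real.pi_lt_d2, Real.pi_pos, abs_nonneg t]
    have h2 := Real.add_one_le_exp (-(γ / 20 * t ^ 2))
    nlinarith [sq_nonneg t]
  have h := mul_norm_prod_sub_prod_le (fun i => intCharFun (ν i) t)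
    (fun i => Complex.exp (t * (∫ y : ℤ, (y : ℝ) ∂(ν i) : ℝ) * Complex.I -
        (variance (fun x : ℤ => (x : ℝ)) (ν i) : ℝ) * t ^ 2 / 2)) (r := r)
    (d := 5 * (1 + B) ^ 2 * |t| ^ 3) (by positivity)
    (fun i => (hν i).unimodal.norm_intCharFun_le_exp hγ0 (hν i).mode_mass_le ht)
    (fun i => by
      rw [norm_gaussian_charFun]
      refine Real.exp_le_exp.2 ?_
      have := (hν i).le_variance
      nlinarith [sq_nonneg t])
    (fun i => norm_intCharFun_sub_gaussian_le (hν i).memLp_four hB (hν i).centralMoment_four_le ht)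
  have hrn : r ^ n = Real.exp (-(n * γ / 20 * t ^ 2)) := by
    rw [hr, ← Real.exp_nat_mul]
    ring_nf
  rw [hrn] at h
  nlinarith [norm_nonneg (∏ i, intCharFun (ν i) t -
    ∏ i, Complex.exp (t * (∫ y : ℤ, (y : ℝ) ∂(ν i) : ℝ) * Complex.I -
        (variance (fun x : ℤ => (x : ℝ)) (ν i) : ℝ) * t ^ 2 / 2))]

/-- Moving the mean of a normal law by at most `1` and its variance `w` by the order of `√w` changes
the characteristic function by a term of the same shape as the error in the comparison of the sum
with its own normal law, by the arithmetic-geometric mean inequality. -/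
theorem norm_gaussian_charFun_sub_le {m μ v w : ℝ} (hw : 0 ≤ w) (hm : |m - μ| ≤ 1)
    (hv : |v - w| ≤ 3 * √w) (hvw : w / 4 ≤ v) (t : ℝ) :
    ‖Complex.exp (t * μ * Complex.I - w * t ^ 2 / 2) -
      Complex.exp (t * m * Complex.I - v * t ^ 2 / 2)‖ ≤
      (2 * |t| + w * |t| ^ 3) * Real.exp (-(w / 8 * t ^ 2)) := by
  have h := norm_exp_sub_exp_le (z := t * μ * Complex.I - w * t ^ 2 / 2)
    (w := t * m * Complex.I - v * t ^ 2 / 2) (c := -(w / 8 * t ^ 2))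
    (by rw [re_gaussian_exponent]; nlinarith [sq_nonneg t])
    (by rw [re_gaussian_exponent]; nlinarith [sq_nonneg t])
  refine h.trans ?_
  rw [mul_comm]
  refine mul_le_mul_of_nonneg_right ?_ (Real.exp_pos _).le
  have h1 : (t * μ * Complex.I - w * t ^ 2 / 2) - (t * m * Complex.I - v * t ^ 2 / 2) =
      ((t * (μ - m) : ℝ) : ℂ) * Complex.I + ((t ^ 2 * (v - w) / 2 : ℝ) : ℂ) := by
    push_cast; ring
  rw [h1]
  have h2 : ‖((t * (μ - m) : ℝ) : ℂ) * Complex.I‖ ≤ |t| := by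
    rw [norm_mul, Complex.norm_I, mul_one, Complex.norm_real, Real.norm_eq_abs, abs_mul,
      abs_sub_comm]
    exact mul_le_of_le_one_right (abs_nonneg _) hm
  have h3 : ‖((t ^ 2 * (v - w) / 2 : ℝ) : ℂ)‖ ≤ 3 / 2 * (√w * |t| ^ 2) := by
    rw [Complex.norm_real, Real.norm_eq_abs, abs_div, abs_mul, abs_two, abs_of_nonneg (sq_nonneg t),
      sq_abs]
    nlinarith [sq_nonneg t]
  refine (norm_add_le _ _).trans ((add_le_add h2 h3).trans ?_)
  -- the mixed term is split by the arithmetic-geometric mean inequality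
  have h4 : 0 ≤ |t| * (1 - √w * |t|) ^ 2 := by positivity
  have h5 : |t| * (1 - √w * |t|) ^ 2 = |t| - 2 * (√w * |t| ^ 2) + √w ^ 2 * |t| ^ 3 := by ring
  rw [h5, Real.sq_sqrt hw] at h4
  have h6 : 0 ≤ w * |t| ^ 3 := by positivity
  linarith [abs_nonneg t]

/-- A bound on `[-π, π]` for the distance to a normal characteristic function gives a pointwise bound for
the masses. Outside `[-π, π]` the normal characteristic function is absorbed by the linear term of
the bound, because `1 ≤ |t|` there. -/
theorem abs_singleton_sub_gaussianPDFReal_le {ρ : Measure ℤ} [IsProbabilityMeasure ρ]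
    {m : ℝ} {v : ℝ≥0} (hv : 0 < v) {a b k : ℝ} (hk : 0 < k) (ha : 0 ≤ a) (hb : 1 ≤ b)
    (hkv : k ≤ v / 2)
    (h : ∀ t : ℝ, |t| ≤ Real.pi →
      ‖intCharFun ρ t - Complex.exp (t * m * Complex.I - v * t ^ 2 / 2)‖ ≤
        (a * |t| ^ 3 + b * |t|) * Real.exp (-k * t ^ 2)) (z : ℤ) :
    |ρ.real {z} - gaussianPDFReal m v z| ≤ a / k ^ 2 + b / k := by
  set ψ : ℝ → ℂ := fun t => Complex.exp (t * m * Complex.I - v * t ^ 2 / 2) with hψ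
  set F : ℝ → ℂ := Set.indicator (Set.Ioc (-Real.pi) Real.pi) (intCharFun ρ) with hF
  set E : ℝ → ℂ := fun t => Complex.exp (-(t * z * Complex.I)) with hE
  have hEn : ∀ t, ‖E t‖ = 1 := fun t => by
    have := norm_exp_mul_I_mul_real (-t) z
    rw [hE]
    push_cast at this
    dsimp only
    rw [← this]
    ring_nf
  set H : ℝ → ℝ := fun t => a * (|t| ^ 3 * Real.exp (-k * t ^ 2)) +
    b * (|t| * Real.exp (-k * t ^ 2)) with hH
  have hi1 := integrable_abs_pow_mul_exp_neg_mul_sq 1 hk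
  simp only [pow_one] at hi1
  have hHi : Integrable H :=
    ((integrable_abs_pow_mul_exp_neg_mul_sq 3 hk).const_mul a).add (hi1.const_mul b)
  have hHint : ∫ t, H t = a / k ^ 2 + b / k := by
    rw [hH, integral_add ((integrable_abs_pow_mul_exp_neg_mul_sq 3 hk).const_mul a)
      (hi1.const_mul b), integral_const_mul, integral_const_mul,
      integral_abs_cube_mul_exp_neg_mul_sq hk, integral_abs_mul_exp_neg_mul_sq hk]
    ring
  have hψn : ∀ t, ‖ψ t‖ ≤ Real.exp (-k * t ^ 2) := fun t => by
    rw [hψ]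
    have := norm_gaussian_charFun t m v
    dsimp only
    rw [this]
    refine Real.exp_le_exp.2 ?_
    nlinarith [sq_nonneg t]
  have hpt : ∀ t, ‖(F t - ψ t) * E t‖ ≤ H t := by
    intro t
    rw [norm_mul, hEn, mul_one]
    have e : H t = (a * |t| ^ 3 + b * |t|) * Real.exp (-k * t ^ 2) := by rw [hH]; ring
    rw [e]
    by_cases htm : t ∈ Set.Ioc (-Real.pi) Real.pi
    · rw [hF, Set.indicator_of_mem htm]
      exact h t (abs_le.2 ⟨htm.1.le, htm.2⟩)
    · rw [hF, Set.indicator_of_notMem htm, zero_sub, norm_neg]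
      have ht : 1 ≤ |t| := by
        by_contra hlt
        rw [not_le, abs_lt] at hlt
        exact htm ⟨by linarith [Real.pi_gt_three, hlt.1], by linarith [Real.pi_gt_three, hlt.2]⟩
      refine (hψn t).trans (le_mul_of_one_le_left (Real.exp_pos _).le ?_)
      have : 0 ≤ a * |t| ^ 3 := by positivity
      nlinarith
  have hψi : Integrable (fun t => ψ t * E t) := by
    refine (integrable_exp_neg_mul_sq hk).mono' (by fun_prop) (Filter.Eventually.of_forall ?_)
    intro t
    rw [norm_mul, hEn, mul_one]
    exact hψn t
  have hFE : (fun t => F t * E t) =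
      Set.indicator (Set.Ioc (-Real.pi) Real.pi) (fun t => intCharFun ρ t * E t) := by
    funext t
    by_cases htm : t ∈ Set.Ioc (-Real.pi) Real.pi <;> simp [hF, htm]
  have hcont : Continuous (fun t => intCharFun ρ t * E t) :=
    (continuous_intCharFun ρ).mul (by fun_prop)
  have hFi : Integrable (fun t => F t * E t) := by
    rw [hFE, integrable_indicator_iff measurableSet_Ioc]
    exact hcont.integrableOn_Ioc
  have key : ((ρ.real {z} - gaussianPDFReal m v z : ℝ) : ℂ) =
      (2 * Real.pi : ℂ)⁻¹ * ∫ t, (F t - ψ t) * E t := by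
    have hg := gaussianPDFReal_eq_integral m hv (z : ℝ)
    push_cast at hg
    rw [Complex.ofReal_sub, measureReal_singleton_eq_integral ρ z, hg, ← mul_sub,
      intervalIntegral.integral_of_le (by linarith [Real.pi_pos])]
    congr 1
    simp_rw [sub_mul]
    rw [integral_sub hFi hψi, hFE, integral_indicator measurableSet_Ioc]
  rw [← hHint, ← Real.norm_eq_abs, ← Complex.norm_real, key, norm_mul]
  have h1 := norm_integral_le_of_norm_le hHi (Filter.Eventually.of_forall hpt)
  refine (mul_le_of_le_one_left (norm_nonneg _) ?_).trans h1
  rw [norm_inv]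
  refine inv_le_one_of_one_le₀ ?_
  have : ‖(2 * Real.pi : ℂ)‖ = 2 * Real.pi := by
    simp [abs_of_pos Real.pi_pos]
  rw [this]
  linarith [Real.pi_gt_three]

/-- Local limit theorem: the mass of the sum at an integer is within `O(1 / n)` of a normal density whose
parameters nearly match. -/
theorem local_limit_gaussianPDFReal {n : ℕ} {ν : Fin n → Measure ℤ}
    [∀ i, IsProbabilityMeasure (ν i)] {γ B : ℝ} (hγ0 : 0 < γ) (hγ1 : γ < 1) (hB : 0 ≤ B)
    (hν : ∀ i, IsAdmissible (ν i) γ B) (hn : 0 < n) {ρ : Measure ℤ} [IsProbabilityMeasure ρ]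
    (hρ : ∀ t, intCharFun ρ t = ∏ i, intCharFun (ν i) t) {μ w : ℝ}
    (hμ : μ = ∑ i, ∫ y : ℤ, (y : ℝ) ∂(ν i))
    (hw : w = ∑ i, variance (fun x : ℤ => (x : ℝ)) (ν i))
    {m : ℝ} {v : ℝ≥0} (hm : |m - μ| ≤ 1) (hv : |v - w| ≤ 3 * √w) (hvw : w / 4 ≤ v) (z : ℤ) :
    |ρ.real {z} - gaussianPDFReal m v z| ≤ 12000 * (1 + B) ^ 2 / (n * γ ^ 2) := by
  have hn' : (1 : ℝ) ≤ n := by exact_mod_cast hn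
  have hw1 : n * γ / 4 ≤ w := by
    have := Finset.card_nsmul_le_sum Finset.univ
      (fun i => variance (fun x : ℤ => (x : ℝ)) (ν i)) (γ / 4) (fun i _ => (hν i).le_variance)
    simp at this
    rw [hw]; linarith
  have hw2 : w ≤ n * (1 + B) := by
    have := Finset.sum_le_card_nsmul Finset.univ
      (fun i => variance (fun x : ℤ => (x : ℝ)) (ν i)) (1 + B)
      (fun i _ => variance_le_one_add (hν i).memLp_four (hν i).centralMoment_four_le)
    simp at this
    rw [hw]; linarith
  have hng : 0 < n * γ := by positivity
  have hw0 : 0 < w := by linarith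
  set k := n * γ / 32 with hk
  have hk0 : 0 < k := by positivity
  have hvpos : 0 < v := by
    have : (0 : ℝ) < v := by linarith
    exact_mod_cast this
  have h := abs_singleton_sub_gaussianPDFReal_le (ρ := ρ) (m := m) (v := v) hvpos hk0
    (a := 11 * n * (1 + B) ^ 2) (b := 2) (by positivity) (by norm_num) (by linarith)
    (fun t ht => ?_) z
  · refine h.trans ?_
    have e1 : 11 * n * (1 + B) ^ 2 / k ^ 2 = 11264 * (1 + B) ^ 2 / (n * γ ^ 2) := by
      rw [hk]; field_simp; norm_num
    have e2 : 2 / k = 64 * γ / (n * γ ^ 2) := by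
      rw [hk]; field_simp; norm_num
    rw [e1, e2, ← add_div]
    refine div_le_div_of_nonneg_right ?_ (by positivity)
    nlinarith
  · have h1 := norm_prod_intCharFun_sub_gaussian_le hγ0 hγ1 hB hν ht
    rw [← hρ, ← hμ, ← hw] at h1
    have h2 := norm_gaussian_charFun_sub_le hw0.le hm hv hvw t
    have h3 : Real.exp (-(n * γ / 20 * t ^ 2)) ≤ Real.exp (-k * t ^ 2) :=
      Real.exp_le_exp.2 (by rw [hk]; nlinarith [sq_nonneg t])
    have h4 : Real.exp (-(w / 8 * t ^ 2)) ≤ Real.exp (-k * t ^ 2) :=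
      Real.exp_le_exp.2 (by rw [hk]; nlinarith [sq_nonneg t])
    have h5 := norm_sub_le_norm_sub_add_norm_sub (intCharFun ρ t)
      (Complex.exp (t * μ * Complex.I - w * t ^ 2 / 2))
      (Complex.exp (t * m * Complex.I - (v : ℝ) * t ^ 2 / 2))
    have hE := (Real.exp_pos (-k * t ^ 2)).le
    have ht3 : 0 ≤ |t| ^ 3 := by positivity
    have hw3 : w ≤ n * (1 + B) ^ 2 := hw2.trans (by nlinarith)
    calc _ ≤ 10 * n * (1 + B) ^ 2 * (|t| ^ 3 * Real.exp (-k * t ^ 2)) +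
          (2 * |t| + n * (1 + B) ^ 2 * |t| ^ 3) * Real.exp (-k * t ^ 2) := by
          refine h5.trans (add_le_add (h1.trans ?_) (h2.trans ?_))
          · gcongr
          · gcongr
      _ = _ := by ring

theorem discretizedGaussian_real_singleton (m : ℝ) {v : ℝ≥0} (hv : 0 < v) (z : ℤ) :
    (discretizedGaussian m v).real {z} =
      ∫ x in Set.Ico ((z : ℝ) - 1 / 2) (z + 1 / 2), gaussianPDFReal m v x := by
  have hme : Measurable fun x : ℝ => ⌊x + 1 / 2⌋ :=
    Int.measurable_floor.comp (measurable_id.add_const (1 / 2 : ℝ))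
  have hpre : (fun x : ℝ => ⌊x + 1 / 2⌋) ⁻¹' {z} = Set.Ico ((z : ℝ) - 1 / 2) (z + 1 / 2) := by
    ext x
    simp only [Set.mem_preimage, Set.mem_singleton_iff, Int.floor_eq_iff, Set.mem_Ico]
    constructor <;> rintro ⟨h1, h2⟩ <;> constructor <;> linarith
  rw [measureReal_def, discretizedGaussian, Measure.map_apply hme (measurableSet_singleton z), hpre,
    gaussianReal_apply_eq_integral _ hv.ne', ENNReal.toReal_ofReal]
  exact integral_nonneg fun x => gaussianPDFReal_nonneg _ _ _

/-- The local limit theorem with a discretized Gaussian in place of a normal density. -/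
theorem local_limit_discretizedGaussian {n : ℕ} {ν : Fin n → Measure ℤ}
    [∀ i, IsProbabilityMeasure (ν i)] {γ B : ℝ} (hγ0 : 0 < γ) (hγ1 : γ < 1) (hB : 0 ≤ B)
    (hν : ∀ i, IsAdmissible (ν i) γ B) (hn : 0 < n) {ρ : Measure ℤ} [IsProbabilityMeasure ρ]
    (hρ : ∀ t, intCharFun ρ t = ∏ i, intCharFun (ν i) t) {μ w : ℝ}
    (hμ : μ = ∑ i, ∫ y : ℤ, (y : ℝ) ∂(ν i))
    (hw : w = ∑ i, variance (fun x : ℤ => (x : ℝ)) (ν i))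
    {m : ℝ} {v : ℝ≥0} (hv0 : 0 < v) (hm : |m - μ| ≤ 1 / 2) (hv : |v - w| ≤ 3 * √w)
    (hvw : w / 4 ≤ v) (z : ℤ) :
    |ρ.real {z} - (discretizedGaussian m v).real {z}| ≤ 12000 * (1 + B) ^ 2 / (n * γ ^ 2) := by
  rw [discretizedGaussian_real_singleton m hv0]
  have hvol : volume.real (Set.Ico ((z : ℝ) - 1 / 2) (z + 1 / 2)) = 1 := by
    rw [Real.volume_real_Ico_of_le (by linarith)]; ring
  have hc : ρ.real {z} = ∫ x in Set.Ico ((z : ℝ) - 1 / 2) (z + 1 / 2), ρ.real {z} := by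
    rw [setIntegral_const, hvol, one_smul]
  rw [hc, ← integral_sub (integrable_const _) (integrable_gaussianPDFReal m v).integrableOn,
    ← Real.norm_eq_abs]
  refine (norm_setIntegral_le_of_norm_le_const (C := 12000 * (1 + B) ^ 2 / (n * γ ^ 2))
    (by simp) fun x hx => ?_).trans (by rw [hvol, mul_one])
  -- moving the argument of the density by at most `1 / 2` amounts to moving its centre
  have hshift : gaussianPDFReal m v x = gaussianPDFReal (m - (x - z)) v z := by
    have := gaussianPDFReal_add (μ := m) (v := v) (z : ℝ) (x - z)
    rw [← this]
    ring_nf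
  rw [hshift, Real.norm_eq_abs]
  refine local_limit_gaussianPDFReal hγ0 hγ1 hB hν hn hρ hμ hw ?_ hv hvw z
  rw [abs_le] at hm ⊢
  constructor <;> linarith [hx.1, hx.2]

/-! ### Discretized Gaussians of prescribed mean and variance -/

/-- The normal variable `m + s x`, for standard normal `x`, rounded to the nearest integer. -/
noncomputable def roundedGaussian (m s x : ℝ) : ℝ := (⌊s * x + m + 1 / 2⌋ : ℤ)

theorem measurable_roundedGaussian (m s : ℝ) : Measurable (roundedGaussian m s) := by
  unfold roundedGaussian
  fun_prop

theorem abs_roundedGaussian_sub_le (m s x : ℝ) : |roundedGaussian m s x - (s * x + m)| ≤ 1 / 2 := by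
  rw [roundedGaussian, abs_le]
  constructor <;> linarith [Int.floor_le (s * x + m + 1 / 2), Int.lt_floor_add_one (s * x + m + 1 / 2)]

theorem integrable_id_stdGaussian : Integrable (fun x : ℝ => x) (gaussianReal 0 1) :=
  memLp_one_iff_integrable.1 (memLp_id_gaussianReal 1)

theorem memLp_two_stdGaussian : MemLp (fun x : ℝ => x) 2 (gaussianReal 0 1) :=
  memLp_id_gaussianReal 2

theorem integral_id_stdGaussian : ∫ x, x ∂(gaussianReal 0 1) = 0 := integral_id_gaussianReal

theorem integral_sq_stdGaussian : ∫ x, x ^ 2 ∂(gaussianReal 0 1) = 1 := by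
  have h := variance_eq_sub memLp_two_stdGaussian
  rw [variance_fun_id_gaussianReal, integral_id_stdGaussian] at h
  simpa using h.symm

theorem memLp_two_roundedGaussian (m s : ℝ) :
    MemLp (roundedGaussian m s) 2 (gaussianReal 0 1) := by
  have h1 : MemLp (fun x => roundedGaussian m s x - (s * x + m)) 2 (gaussianReal 0 1) := by
    refine MemLp.of_bound ?_ (1 / 2) (Filter.Eventually.of_forall fun x =>
      abs_roundedGaussian_sub_le m s x)
    exact ((measurable_roundedGaussian m s).sub (by fun_prop)).aestronglyMeasurable
  have h2 : MemLp (fun x : ℝ => s * x + m) 2 (gaussianReal 0 1) :=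
    (memLp_two_stdGaussian.const_mul s).add (memLp_const m)
  convert h1.add h2 using 1
  funext x
  simp

theorem integrable_roundedGaussian (m s : ℝ) :
    Integrable (roundedGaussian m s) (gaussianReal 0 1) :=
  (memLp_two_roundedGaussian m s).integrable (by norm_num)

theorem integrable_roundedGaussian_sq (m s : ℝ) :
    Integrable (fun x => roundedGaussian m s x ^ 2) (gaussianReal 0 1) :=
  (memLp_two_roundedGaussian m s).integrable_sq

theorem discretizedGaussian_sq_eq_map (m s : ℝ) :
    discretizedGaussian m (s ^ 2).toNNReal =
      (gaussianReal 0 1).map (fun x => ⌊s * x + m + 1 / 2⌋) := by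
  have h : gaussianReal m (s ^ 2).toNNReal = (gaussianReal 0 1).map (fun x => s * x + m) := by
    have : (fun x => s * x + m) = (fun y => y + m) ∘ (fun x => s * x) := rfl
    rw [this, ← Measure.map_map (by fun_prop) (by fun_prop), gaussianReal_map_const_mul,
      gaussianReal_map_add_const]
    congr 1
    · simp
    · ext
      simp [sq_nonneg]
  rw [discretizedGaussian, h, Measure.map_map (by fun_prop) (by fun_prop)]
  rfl

theorem integral_discretizedGaussian_sq (m s : ℝ) :
    ∫ y : ℤ, (y : ℝ) ∂(discretizedGaussian m (s ^ 2).toNNReal) =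
      ∫ x, roundedGaussian m s x ∂(gaussianReal 0 1) := by
  rw [discretizedGaussian_sq_eq_map, integral_map (by fun_prop) (by fun_prop)]
  rfl

theorem variance_discretizedGaussian_sq (m s : ℝ) :
    variance (fun y : ℤ => (y : ℝ)) (discretizedGaussian m (s ^ 2).toNNReal) =
      variance (roundedGaussian m s) (gaussianReal 0 1) := by
  rw [discretizedGaussian_sq_eq_map, variance_map (by fun_prop) (by fun_prop)]
  rfl

theorem memLp_two_discretizedGaussian_sq (m s : ℝ) :
    MemLp (fun y : ℤ => (y : ℝ)) 2 (discretizedGaussian m (s ^ 2).toNNReal) := by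
  rw [discretizedGaussian_sq_eq_map, memLp_map_measure_iff (by fun_prop) (by fun_prop)]
  exact memLp_two_roundedGaussian m s

/-- Rounding is discontinuous only on a countable set of arguments, which a nondegenerate normal
law does not charge. -/
theorem continuousAt_integral_comp_roundedGaussian {g : ℝ → ℝ} (hg : Continuous g)
    (hg2 : ∀ y, |g y| ≤ 1 + y ^ 2) {m₀ s₀ : ℝ} (hs : s₀ ≠ 0) :
    ContinuousAt (fun p : ℝ × ℝ => ∫ x, g (roundedGaussian p.1 p.2 x) ∂(gaussianReal 0 1))
      (m₀, s₀) := by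
  refine continuousAt_of_dominated
    (bound := fun x => 1 + ((|s₀| + 1) * |x| + (|m₀| + 2)) ^ 2) ?_ ?_ ?_ ?_
  · exact Filter.Eventually.of_forall fun p =>
      (hg.measurable.comp (measurable_roundedGaussian p.1 p.2)).aestronglyMeasurable
  · have hnhds : ∀ᶠ p : ℝ × ℝ in nhds (m₀, s₀), |p.1| < |m₀| + 1 ∧ |p.2| < |s₀| + 1 := by
      refine Filter.Eventually.and ?_ ?_
      · exact (continuous_fst.abs.tendsto (m₀, s₀)).eventually_lt_const (by simp)
      · exact (continuous_snd.abs.tendsto (m₀, s₀)).eventually_lt_const (by simp)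
    filter_upwards [hnhds] with p hp
    refine Filter.Eventually.of_forall fun x => ?_
    refine (hg2 _).trans ?_
    rw [← sq_abs (roundedGaussian p.1 p.2 x)]
    have h1 := abs_roundedGaussian_sub_le p.1 p.2 x
    have h2 : |roundedGaussian p.1 p.2 x| ≤
        |roundedGaussian p.1 p.2 x - (p.2 * x + p.1)| + |p.2 * x + p.1| := by
      simpa using abs_add_le (roundedGaussian p.1 p.2 x - (p.2 * x + p.1)) (p.2 * x + p.1)
    have h3 : |p.2 * x + p.1| ≤ |p.2| * |x| + |p.1| := by
      simpa [abs_mul] using abs_add_le (p.2 * x) p.1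
    have h4 : |p.2| * |x| ≤ (|s₀| + 1) * |x| := by
      gcongr
      exact hp.2.le
    gcongr
    linarith [hp.1]
  · refine (integrable_const _).add ?_
    have : MemLp (fun x : ℝ => (|s₀| + 1) * |x| + (|m₀| + 2)) 2 (gaussianReal 0 1) :=
      (memLp_two_stdGaussian.abs.const_mul _).add (memLp_const _)
    exact this.integrable_sq
  · have : NullSingletonClass (gaussianReal 0 1) := nullSingletonClass_gaussianReal one_ne_zero
    have hcount : ((fun x : ℝ => s₀ * x + m₀ + 1 / 2) ⁻¹' Set.range (Int.cast : ℤ → ℝ)).Countable := by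
      refine (Set.countable_range _).preimage fun x y hxy => ?_
      have : s₀ * x = s₀ * y := by linarith
      exact mul_left_cancel₀ hs this
    filter_upwards [compl_mem_ae_iff.2 (hcount.measure_zero (gaussianReal 0 1))] with x hx
    refine hg.continuousAt.comp ?_
    set u := s₀ * x + m₀ + 1 / 2 with hu
    have hlt : ((⌊u⌋ : ℤ) : ℝ) < u := lt_of_le_of_ne (Int.floor_le u) fun h => hx ⟨⌊u⌋, h⟩
    have hcont : ContinuousAt (fun p : ℝ × ℝ => p.2 * x + p.1 + 1 / 2) (m₀, s₀) := by fun_prop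
    have hev : ∀ᶠ p : ℝ × ℝ in nhds (m₀, s₀), ((⌊u⌋ : ℤ) : ℝ) = roundedGaussian p.1 p.2 x := by
      filter_upwards [hcont.eventually_const_lt hlt,
        hcont.eventually_lt_const (Int.lt_floor_add_one u)] with p h1 h2
      rw [roundedGaussian]
      congr 1
      exact (Int.floor_eq_iff.2 ⟨h1.le, h2⟩).symm
    exact continuousAt_const.congr hev

theorem abs_integral_roundedGaussian_sub_le (m s : ℝ) :
    |∫ x, roundedGaussian m s x ∂(gaussianReal 0 1) - m| ≤ 1 / 2 := by
  have hi : Integrable (fun x : ℝ => s * x + m) (gaussianReal 0 1) :=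
    (integrable_id_stdGaussian.const_mul s).add (integrable_const m)
  have h1 : ∫ x, (s * x + m) ∂(gaussianReal 0 1) = m := by
    rw [integral_add (integrable_id_stdGaussian.const_mul s) (integrable_const m),
      integral_const_mul, integral_id_stdGaussian]
    simp
  have h2 : ∫ x, roundedGaussian m s x ∂(gaussianReal 0 1) - m =
      ∫ x, (roundedGaussian m s x - (s * x + m)) ∂(gaussianReal 0 1) := by
    rw [integral_sub (integrable_roundedGaussian m s) hi, h1]
  rw [h2, ← Real.norm_eq_abs]
  have := norm_integral_le_of_norm_le_const (μ := gaussianReal 0 1) (C := 1 / 2)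
    (f := fun x => roundedGaussian m s x - (s * x + m))
    (Filter.Eventually.of_forall fun x => abs_roundedGaussian_sub_le m s x)
  simpa using this

theorem integral_roundedGaussian_strictMono {s : ℝ} (hs : 0 < s) :
    StrictMono fun m => ∫ x, roundedGaussian m s x ∂(gaussianReal 0 1) := by
  intro m m' hm
  dsimp only
  rw [← sub_pos, ← integral_sub (integrable_roundedGaussian m' s) (integrable_roundedGaussian m s)]
  refine (integral_pos_iff_support_of_nonneg ?_
    ((integrable_roundedGaussian m' s).sub (integrable_roundedGaussian m s))).2 ?_
  · intro x
    have : ⌊s * x + m + 1 / 2⌋ ≤ ⌊s * x + m' + 1 / 2⌋ := Int.floor_mono (by linarith)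
    exact sub_nonneg.2 (Int.cast_le (R := ℝ).2 this)
  · have hsub : Set.Ioo ((-m' - 1 / 2) / s) ((-m - 1 / 2) / s) ⊆
        Function.support fun x => roundedGaussian m' s x - roundedGaussian m s x := by
      intro x hx
      have h1 := (div_lt_iff₀ hs).1 hx.1
      have h2 := (lt_div_iff₀ hs).1 hx.2
      have h3 : ⌊s * x + m + 1 / 2⌋ < 0 := Int.floor_lt.2 (by push_cast; linarith)
      have h4 : 0 ≤ ⌊s * x + m' + 1 / 2⌋ := Int.le_floor.2 (by push_cast; linarith)
      have : (⌊s * x + m + 1 / 2⌋ : ℝ) < ⌊s * x + m' + 1 / 2⌋ := by exact_mod_cast h3.trans_le h4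
      simp only [Function.mem_support, roundedGaussian]
      linarith
    refine lt_of_lt_of_le (pos_iff_ne_zero.2 fun h0 => ?_) (measure_mono hsub)
    have := gaussianReal_absolutelyContinuous' 0 one_ne_zero h0
    rw [Real.volume_Ioo, ENNReal.ofReal_eq_zero, sub_nonpos] at this
    have h5 : (-m' - 1 / 2) / s < (-m - 1 / 2) / s := by gcongr
    linarith

theorem variance_roundedGaussian_eq (m s : ℝ) :
    variance (roundedGaussian m s) (gaussianReal 0 1) =
      ∫ x, roundedGaussian m s x ^ 2 ∂(gaussianReal 0 1) -
        (∫ x, roundedGaussian m s x ∂(gaussianReal 0 1)) ^ 2 :=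
  variance_eq_sub (memLp_two_roundedGaussian m s)

theorem abs_variance_roundedGaussian_sub_le (m : ℝ) {s : ℝ} (hs : 0 < s) :
    |variance (roundedGaussian m s) (gaussianReal 0 1) - s ^ 2| ≤ s + 1 / 2 := by
  have hA := abs_integral_roundedGaussian_sub_le m s
  have hY := integrable_roundedGaussian m s
  have hY2 := integrable_roundedGaussian_sq m s
  rw [variance_roundedGaussian_eq]
  have h1 : ∫ x, ((roundedGaussian m s x - m) ^ 2 - s ^ 2 * x ^ 2) ∂(gaussianReal 0 1) =
      ∫ x, roundedGaussian m s x ^ 2 ∂(gaussianReal 0 1) -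
        2 * m * ∫ x, roundedGaussian m s x ∂(gaussianReal 0 1) + m ^ 2 - s ^ 2 := by
    have e : ∀ x, (roundedGaussian m s x - m) ^ 2 - s ^ 2 * x ^ 2 =
        roundedGaussian m s x ^ 2 - 2 * m * roundedGaussian m s x + m ^ 2 - s ^ 2 * x ^ 2 := by
      intro x; ring
    simp_rw [e]
    rw [integral_sub, integral_add, integral_sub, integral_const_mul, integral_const_mul,
      integral_sq_stdGaussian]
    · simp
    · exact hY2
    · exact hY.const_mul _
    · exact hY2.sub (hY.const_mul _)
    · exact integrable_const _
    · exact (hY2.sub (hY.const_mul _)).add (integrable_const _)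
    · exact memLp_two_stdGaussian.integrable_sq.const_mul _
  have h2 : |∫ x, ((roundedGaussian m s x - m) ^ 2 - s ^ 2 * x ^ 2) ∂(gaussianReal 0 1)| ≤
      s + 1 / 4 := by
    have hi0 : Integrable (fun x : ℝ => 1 + x ^ 2) (gaussianReal 0 1) :=
      (integrable_const _).add memLp_two_stdGaussian.integrable_sq
    have hi : Integrable (fun x : ℝ => s / 2 * (1 + x ^ 2) + 1 / 4) (gaussianReal 0 1) :=
      (hi0.const_mul _).add (integrable_const _)
    have hint : ∫ x : ℝ, (s / 2 * (1 + x ^ 2) + 1 / 4) ∂(gaussianReal 0 1) = s + 1 / 4 := by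
      rw [integral_add (hi0.const_mul _) (integrable_const _), integral_const_mul,
        integral_add (integrable_const _) memLp_two_stdGaussian.integrable_sq,
        integral_sq_stdGaussian]
      simp
      ring
    rw [← hint, ← Real.norm_eq_abs]
    refine norm_integral_le_of_norm_le hi (Filter.Eventually.of_forall fun x => ?_)
    have hd := abs_roundedGaussian_sub_le m s x
    set d := roundedGaussian m s x - (s * x + m) with hd'
    have e : (roundedGaussian m s x - m) ^ 2 - s ^ 2 * x ^ 2 = 2 * (s * x) * d + d ^ 2 := by
      have : roundedGaussian m s x = d + (s * x + m) := by rw [hd']; ring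
      rw [this]; ring
    rw [e, Real.norm_eq_abs]
    refine (abs_add_le _ _).trans (add_le_add ?_ ?_)
    · rw [abs_mul, abs_mul, abs_mul, abs_two, abs_of_pos hs]
      have h3 : 2 * |x| ≤ 1 + x ^ 2 := by rw [← sq_abs]; nlinarith [sq_nonneg (|x| - 1)]
      have h4 : 2 * (s * |x|) * |d| ≤ 2 * (s * |x|) * (1 / 2) := by gcongr
      nlinarith
    · rw [abs_of_nonneg (sq_nonneg d), ← sq_abs]
      nlinarith [abs_nonneg d]
  rw [h1] at h2
  set A := ∫ x, roundedGaussian m s x ∂(gaussianReal 0 1)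
  set V := ∫ x, roundedGaussian m s x ^ 2 ∂(gaussianReal 0 1)
  have h3 : (A - m) ^ 2 ≤ 1 / 4 := by
    rw [← sq_abs]
    nlinarith [abs_nonneg (A - m)]
  rw [abs_le] at h2 ⊢
  constructor <;> nlinarith [sq_nonneg (A - m)]

theorem exists_roundedGaussian_mean_eq {s : ℝ} (hs : 0 < s) (μ : ℝ) :
    ∃ m, ∫ x, roundedGaussian m s x ∂(gaussianReal 0 1) = μ := by
  have hcont : Continuous fun m => ∫ x, roundedGaussian m s x ∂(gaussianReal 0 1) := by
    rw [continuous_iff_continuousAt]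
    intro m₀
    have h := continuousAt_integral_comp_roundedGaussian (g := fun y => y) continuous_id
      (fun y => by rw [← sq_abs]; nlinarith [sq_nonneg (|y| - 1), abs_nonneg y]) (m₀ := m₀) hs.ne'
    exact h.comp (f := fun m => (m, s)) (by fun_prop)
  refine mem_range_of_exists_le_of_exists_ge hcont ⟨μ - 1, ?_⟩ ⟨μ + 1, ?_⟩
  · have := abs_le.1 (abs_integral_roundedGaussian_sub_le (μ - 1) s)
    linarith [this.2]
  · have := abs_le.1 (abs_integral_roundedGaussian_sub_le (μ + 1) s)
    linarith [this.1]

/-- Every mean `μ` and every variance `w ≥ 4` is attained by a discretized Gaussian. The centre `m`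
is determined by the scale `s` and depends continuously on it, by strict monotonicity of the mean
in `m`; the intermediate value theorem then gives the scale. -/
theorem exists_roundedGaussian_mean_variance_eq (μ : ℝ) {w : ℝ} (hw : 4 ≤ w) :
    ∃ m s : ℝ, 0 < s ∧ ∫ x, roundedGaussian m s x ∂(gaussianReal 0 1) = μ ∧
      variance (roundedGaussian m s) (gaussianReal 0 1) = w := by
  choose! f hf using fun (s : ℝ) (hs : 0 < s) => exists_roundedGaussian_mean_eq hs μ
  have hA : ∀ {m₀ s₀ : ℝ}, 0 < s₀ → ContinuousAt
      (fun p : ℝ × ℝ => ∫ x, roundedGaussian p.1 p.2 x ∂(gaussianReal 0 1)) (m₀, s₀) := fun hs =>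
    continuousAt_integral_comp_roundedGaussian (g := fun y => y) continuous_id
      (fun y => by rw [← sq_abs]; nlinarith [sq_nonneg (|y| - 1), abs_nonneg y]) hs.ne'
  have hfc : ∀ s₀, 0 < s₀ → ContinuousAt f s₀ := by
    intro s₀ hs₀
    rw [Metric.continuousAt_iff']
    intro ε hε
    have hm := integral_roundedGaussian_strictMono hs₀
    have h1 : ∫ x, roundedGaussian (f s₀ - ε) s₀ x ∂(gaussianReal 0 1) < μ := by
      rw [← hf s₀ hs₀]; exact hm (by linarith)
    have h2 : μ < ∫ x, roundedGaussian (f s₀ + ε) s₀ x ∂(gaussianReal 0 1) := by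
      conv_lhs => rw [← hf s₀ hs₀]
      exact hm (by linarith)
    have c1 : ContinuousAt (fun s => ∫ x, roundedGaussian (f s₀ - ε) s x ∂(gaussianReal 0 1)) s₀ :=
      (hA hs₀).comp (f := fun s => (f s₀ - ε, s)) (by fun_prop)
    have c2 : ContinuousAt (fun s => ∫ x, roundedGaussian (f s₀ + ε) s x ∂(gaussianReal 0 1)) s₀ :=
      (hA hs₀).comp (f := fun s => (f s₀ + ε, s)) (by fun_prop)
    filter_upwards [c1.eventually_lt_const h1, c2.eventually_const_lt h2, lt_mem_nhds hs₀]
      with s e1 e2 e3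
    have hm' := integral_roundedGaussian_strictMono e3
    have h3 := hf s e3
    have e1' := hm'.lt_iff_lt.1 (e1.trans_eq h3.symm)
    have e2' := hm'.lt_iff_lt.1 (h3.trans_lt e2)
    rw [Real.dist_eq, abs_lt]
    constructor <;> linarith
  have hVc : ∀ s₀, 0 < s₀ → ContinuousAt
      (fun s => ∫ x, roundedGaussian (f s) s x ^ 2 ∂(gaussianReal 0 1)) s₀ := by
    intro s₀ hs₀
    have h := continuousAt_integral_comp_roundedGaussian (g := fun y => y ^ 2) (by fun_prop)
      (fun y => by rw [abs_of_nonneg (sq_nonneg y)]; linarith) (m₀ := f s₀) hs₀.ne'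
    exact h.comp (f := fun s => (f s, s)) ((hfc s₀ hs₀).prodMk continuousAt_id)
  have hvar : ∀ s, 0 < s → variance (roundedGaussian (f s) s) (gaussianReal 0 1) =
      ∫ x, roundedGaussian (f s) s x ^ 2 ∂(gaussianReal 0 1) - μ ^ 2 := by
    intro s hs
    rw [variance_roundedGaussian_eq, hf s hs]
  have hsq : √w ^ 2 = w := Real.sq_sqrt (by linarith)
  have hsq0 := Real.sqrt_nonneg w
  have hivt := intermediate_value_Icc (a := 1 / 2) (b := √w + 2) (by linarith)
    (f := fun s => ∫ x, roundedGaussian (f s) s x ^ 2 ∂(gaussianReal 0 1) - μ ^ 2)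
    (fun s hs => ((hVc s (by linarith [hs.1])).sub continuousAt_const).continuousWithinAt)
  have hmem : w ∈ Set.Icc (∫ x, roundedGaussian (f (1 / 2)) (1 / 2) x ^ 2 ∂(gaussianReal 0 1) - μ ^ 2)
      (∫ x, roundedGaussian (f (√w + 2)) (√w + 2) x ^ 2 ∂(gaussianReal 0 1) - μ ^ 2) := by
    rw [← hvar _ (by norm_num), ← hvar _ (by linarith)]
    constructor
    · have := abs_le.1 (abs_variance_roundedGaussian_sub_le (f (1 / 2)) (s := 1 / 2) (by norm_num))
      linarith [this.2]
    · have := abs_le.1 (abs_variance_roundedGaussian_sub_le (f (√w + 2)) (s := √w + 2)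
        (by linarith))
      nlinarith [this.1]
  obtain ⟨s, hs, hsw⟩ := hivt hmem
  have hs0 : 0 < s := by linarith [hs.1]
  exact ⟨f s, s, hs0, hf s hs0, (hvar s hs0).trans hsw⟩

theorem exists_discretizedGaussian_mean_variance_eq (μ : ℝ) {w : ℝ} (hw : 4 ≤ w) :
    ∃ (m : ℝ) (v : ℝ≥0), 0 < v ∧ |m - μ| ≤ 1 / 2 ∧ |(v : ℝ) - w| ≤ 3 * √w ∧ w / 4 ≤ v ∧
      MemLp (fun y : ℤ => (y : ℝ)) 2 (discretizedGaussian m v) ∧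
      ∫ y : ℤ, (y : ℝ) ∂(discretizedGaussian m v) = μ ∧
      variance (fun y : ℤ => (y : ℝ)) (discretizedGaussian m v) = w := by
  obtain ⟨m, s, hs, hμ, hv⟩ := exists_roundedGaussian_mean_variance_eq μ hw
  have hA := abs_integral_roundedGaussian_sub_le m s
  have hV := abs_variance_roundedGaussian_sub_le m hs
  rw [hμ, abs_sub_comm] at hA
  rw [hv, abs_sub_comm] at hV
  have hsq : √w ^ 2 = w := Real.sq_sqrt (by linarith)
  have hcoe : (((s ^ 2).toNNReal : ℝ≥0) : ℝ) = s ^ 2 := Real.coe_toNNReal _ (sq_nonneg s)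
  have hq2 : 2 ≤ √w := Real.le_sqrt_of_sq_le (by linarith)
  have hV' := abs_le.1 hV
  refine ⟨m, (s ^ 2).toNNReal, Real.toNNReal_pos.2 (by positivity), hA, ?_, ?_,
    memLp_two_discretizedGaussian_sq m s, ?_, ?_⟩
  · rw [hcoe]
    have : s ≤ 2 * √w := by
      by_contra! h
      nlinarith [hV'.2]
    linarith
  · rw [hcoe]
    by_contra! h
    have : s ≤ √w / 2 := by
      by_contra! h'
      nlinarith
    nlinarith [hV'.1]
  · rw [integral_discretizedGaussian_sq, hμ]
  · rw [variance_discretizedGaussian_sq, hv]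

/-! ### Total variation, windows, and finite nets -/

theorem hasSum_indicator_compl_measureReal (ρ : Measure ℤ) [IsProbabilityMeasure ρ]
    (W : Finset ℤ) :
    HasSum (fun x : ℤ => if x ∈ W then 0 else ρ.real {x}) (ρ.real (W : Set ℤ)ᶜ) := by
  have h1 : HasSum (fun x : ℤ => if x ∈ W then ρ.real {x} else 0)
      (∑ x ∈ W, if x ∈ W then ρ.real {x} else 0) :=
    hasSum_sum_of_ne_finset_zero fun x hx => by simp [hx]
  have h2 := (hasSum_measureReal_singleton ρ).sub h1
  rw [probReal_compl_eq_one_sub W.measurableSet, ← sum_measureReal_singleton]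
  have h3 : ∑ x ∈ W, (if x ∈ W then ρ.real {x} else 0) = ∑ x ∈ W, ρ.real {x} :=
    Finset.sum_congr rfl fun x hx => by simp [hx]
  rw [h3] at h2
  have h4 : (fun x : ℤ => if x ∈ W then 0 else ρ.real {x}) =
      fun x => ρ.real {x} - if x ∈ W then ρ.real {x} else 0 := by
    funext x
    split_ifs <;> simp
  rwa [h4]

/-- Total variation from a pointwise bound on a finite window and a bound for the masses outside. -/
theorem tvDist_le_of_window {ρ σ : Measure ℤ} [IsProbabilityMeasure ρ] [IsProbabilityMeasure σ]
    (W : Finset ℤ) {s η₁ η₂ : ℝ} (hs : ∀ x ∈ W, |ρ.real {x} - σ.real {x}| ≤ s)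
    (h1 : ρ.real (W : Set ℤ)ᶜ ≤ η₁) (h2 : σ.real (W : Set ℤ)ᶜ ≤ η₂) :
    tvDist ρ σ ≤ 1 / 2 * (W.card * s + η₁ + η₂) := by
  have hW : HasSum (fun x : ℤ => if x ∈ W then s else 0) (W.card * s) := by
    have h : HasSum (fun x : ℤ => if x ∈ W then s else 0) (∑ x ∈ W, if x ∈ W then s else 0) :=
      hasSum_sum_of_ne_finset_zero fun x hx => by simp [hx]
    have h3 : ∑ x ∈ W, (if x ∈ W then s else 0) = W.card * s := by
      rw [Finset.sum_congr rfl fun x hx => if_pos hx]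
      simp
    rwa [h3] at h
  have hsum := (hW.add (hasSum_indicator_compl_measureReal ρ W)).add
    (hasSum_indicator_compl_measureReal σ W)
  have hle : ∀ x : ℤ, |ρ.real {x} - σ.real {x}| ≤ (if x ∈ W then s else 0) +
      (if x ∈ W then 0 else ρ.real {x}) + (if x ∈ W then 0 else σ.real {x}) := by
    intro x
    by_cases hx : x ∈ W
    · simpa [hx] using hs x hx
    · simp only [hx, if_false, zero_add]
      rw [abs_le]
      constructor <;> linarith [measureReal_nonneg (μ := ρ) (s := {x}),
        measureReal_nonneg (μ := σ) (s := {x})]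
  have hsm : Summable fun x : ℤ => |ρ.real {x} - σ.real {x}| :=
    Summable.of_nonneg_of_le (fun x => abs_nonneg _) hle hsum.summable
  have := hasSum_le hle hsm.hasSum hsum
  rw [tvDist]
  linarith

/-- The integers at distance at most `r` from `a`. -/
noncomputable def intWindow (a r : ℝ) : Finset ℤ := Finset.Icc ⌈a - r⌉ ⌊a + r⌋

theorem mem_intWindow {a r : ℝ} {x : ℤ} : x ∈ intWindow a r ↔ |(x : ℝ) - a| ≤ r := by
  rw [intWindow, Finset.mem_Icc, Int.ceil_le, Int.le_floor, abs_le]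
  constructor <;> rintro ⟨h1, h2⟩ <;> constructor <;> linarith

theorem card_Icc_floor_le {u v c : ℝ} {i j : ℤ} (hi : u ≤ i) (hj : (j : ℝ) ≤ v)
    (hc : v - u + 1 ≤ c) (hc0 : 0 ≤ c) : ((Finset.Icc i j).card : ℝ) ≤ c := by
  rw [Int.card_Icc]
  have h : (((j + 1 - i).toNat : ℤ) : ℝ) ≤ c := by
    rw [Int.toNat_eq_max, Int.cast_max]
    refine max_le ?_ (by simpa using hc0)
    push_cast
    linarith
  exact_mod_cast h

theorem card_intWindow_le (a : ℝ) {r : ℝ} (hr : 0 ≤ r) :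
    ((intWindow a r).card : ℝ) ≤ 2 * r + 1 :=
  card_Icc_floor_le (Int.le_ceil _) (Int.floor_le _) (by linarith) (by linarith)

theorem measureReal_compl_intWindow_le {ρ : Measure ℤ} [IsProbabilityMeasure ρ]
    (h2 : MemLp (fun x : ℤ => (x : ℝ)) 2 ρ) {r : ℝ} (hr : 0 < r) :
    ρ.real (intWindow (∫ y : ℤ, (y : ℝ) ∂ρ) r : Set ℤ)ᶜ ≤
      variance (fun x : ℤ => (x : ℝ)) ρ / r ^ 2 := by
  have h := meas_ge_le_variance_div_sq h2 hr
  have hsub : (intWindow (∫ y : ℤ, (y : ℝ) ∂ρ) r : Set ℤ)ᶜ ⊆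
      {x : ℤ | r ≤ |(x : ℝ) - ∫ y : ℤ, (y : ℝ) ∂ρ|} := by
    intro x hx
    rw [Set.mem_compl_iff, Finset.mem_coe, mem_intWindow, not_le] at hx
    exact hx.le
  exact ENNReal.toReal_le_of_le_ofReal (div_nonneg (variance_nonneg _ _) (sq_nonneg r))
    ((measure_mono hsub).trans h)

/-- Total variation from a uniform pointwise bound, for laws with the same mean and variance: the masses
outside a window of radius `r` around the mean are bounded by Chebyshev's inequality. -/
theorem tvDist_le_of_mean_variance_eq {ρ σ : Measure ℤ} [IsProbabilityMeasure ρ]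
    [IsProbabilityMeasure σ] (hρ : MemLp (fun x : ℤ => (x : ℝ)) 2 ρ)
    (hσ : MemLp (fun x : ℤ => (x : ℝ)) 2 σ)
    (hmean : ∫ x : ℤ, (x : ℝ) ∂σ = ∫ x : ℤ, (x : ℝ) ∂ρ)
    (hvar : variance (fun x : ℤ => (x : ℝ)) σ = variance (fun x : ℤ => (x : ℝ)) ρ)
    {s r : ℝ} (hr : 0 < r) (hs : ∀ x : ℤ, |ρ.real {x} - σ.real {x}| ≤ s) :
    tvDist ρ σ ≤ (r + 1 / 2) * s + variance (fun x : ℤ => (x : ℝ)) ρ / r ^ 2 := by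
  have h1 := measureReal_compl_intWindow_le hρ hr
  have h2 := measureReal_compl_intWindow_le hσ hr
  rw [hmean, hvar] at h2
  refine (tvDist_le_of_window _ (fun x _ => hs x) h1 h2).trans ?_
  have hs0 : 0 ≤ s := (abs_nonneg _).trans (hs 0)
  have := mul_le_mul_of_nonneg_right (card_intWindow_le (∫ y : ℤ, (y : ℝ) ∂ρ) hr.le) hs0
  linarith

/-- Translating a window that carries most of the mass towards the mode does not decrease its mass,
so the translate cannot be disjoint from the window. -/
theorem not_forall_translate {ρ : Measure ℤ} [IsProbabilityMeasure ρ] (W : Finset ℤ)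
    (hW : ρ.real (W : Set ℤ)ᶜ ≤ 1 / 4) {k : ℤ} (hk : ∀ x ∈ W, x + k ∉ W)
    (hle : ∀ x ∈ W, ρ.real {x} ≤ ρ.real {x + k}) : False := by
  have h1 : ρ.real (W : Set ℤ) ≤ ρ.real ((W.map (addRightEmbedding k) : Finset ℤ) : Set ℤ) := by
    rw [← sum_measureReal_singleton, ← sum_measureReal_singleton, Finset.sum_map]
    exact Finset.sum_le_sum hle
  have h2 : ρ.real ((W.map (addRightEmbedding k) : Finset ℤ) : Set ℤ) ≤ ρ.real (W : Set ℤ)ᶜ := by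
    refine measureReal_mono ?_
    intro y hy
    rw [Finset.mem_coe, Finset.mem_map] at hy
    obtain ⟨x, hx, rfl⟩ := hy
    exact hk x hx
  have h3 := probReal_compl_eq_one_sub (μ := ρ) W.measurableSet
  linarith

theorem le_of_forall_le_succ {d : ℤ → ℝ} {M : ℤ} (h : ∀ x < M, d x ≤ d (x + 1)) {x y : ℤ}
    (hxy : x ≤ y) (hy : y ≤ M) : d x ≤ d y := by
  induction y, hxy using Int.leInduction with
  | base => exact le_rfl
  | succ n hn ih => exact (ih (by omega)).trans (h n (by omega))

theorem le_of_forall_succ_le {d : ℤ → ℝ} {M : ℤ} (h : ∀ x, M ≤ x → d (x + 1) ≤ d x) {x y : ℤ}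
    (hxy : x ≤ y) (hx : M ≤ x) : d y ≤ d x := by
  induction y, hxy using Int.leInduction with
  | base => exact le_rfl
  | succ n hn ih => exact (h n (by omega)).trans ih

/-- A window of radius `r` around the mean carries mass at least `3 / 4`; if the mode were farther than
`3 r + 1` from the mean, the window could be translated towards the mode off itself. -/
theorem IsUnimodal.exists_isMode_near_mean {ρ : Measure ℤ} [IsProbabilityMeasure ρ]
    (hu : IsUnimodal ρ) (h2 : MemLp (fun x : ℤ => (x : ℝ)) 2 ρ) {r : ℝ} (hr : 0 < r)
    (hvar : 4 * variance (fun x : ℤ => (x : ℝ)) ρ ≤ r ^ 2) :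
    ∃ M : ℤ, IsMode ρ M ∧ |(M : ℝ) - ∫ x : ℤ, (x : ℝ) ∂ρ| ≤ 3 * r + 1 := by
  obtain ⟨M, hmode, hdown, hup⟩ := hu.exists_isMode
  refine ⟨M, hmode, ?_⟩
  set a := ∫ x : ℤ, (x : ℝ) ∂ρ with ha
  have hW : ρ.real (intWindow a r : Set ℤ)ᶜ ≤ 1 / 4 := by
    refine (measureReal_compl_intWindow_le h2 hr).trans ?_
    rw [div_le_iff₀ (by positivity)]
    linarith
  have hk1 : 2 * r < ((⌊2 * r⌋ + 1 : ℤ) : ℝ) := by push_cast; exact Int.lt_floor_add_one _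
  have hk2 : ((⌊2 * r⌋ + 1 : ℤ) : ℝ) ≤ 2 * r + 1 := by
    push_cast
    linarith [Int.floor_le (2 * r)]
  set k := ⌊2 * r⌋ + 1
  have hk0 : 0 ≤ k := by
    have : (0 : ℝ) ≤ k := by linarith
    exact_mod_cast this
  by_contra hcon
  rw [not_le, lt_abs] at hcon
  rcases hcon with h | h
  · refine not_forall_translate (intWindow a r) hW (k := k) (fun x hx hxk => ?_) fun x hx => ?_
    · rw [mem_intWindow, abs_le] at hx hxk
      push_cast at hxk
      linarith [hx.1, hxk.2]
    · rw [mem_intWindow, abs_le] at hx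
      refine le_of_forall_le_succ (d := fun x => ρ.real {x}) hup (by omega) ?_
      have : ((x + k : ℤ) : ℝ) ≤ M := by push_cast; linarith [hx.2]
      exact_mod_cast this
  · refine not_forall_translate (intWindow a r) hW (k := -k) (fun x hx hxk => ?_) fun x hx => ?_
    · rw [mem_intWindow, abs_le] at hx hxk
      push_cast at hxk
      linarith [hx.2, hxk.1]
    · rw [mem_intWindow, abs_le] at hx
      refine le_of_forall_succ_le (d := fun x => ρ.real {x}) hdown (by omega) ?_
      have : (M : ℝ) ≤ ((x + -k : ℤ) : ℝ) := by push_cast; linarith [hx.1]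
      exact_mod_cast this

/-- The probability masses of `ρ` at the points of `[z - r, z + r]`, rounded down to multiples of
`1 / T`. -/
noncomputable def windowCode (r T : ℕ) (z : ℤ) (ρ : ProbabilityMeasure ℤ) :
    Fin (2 * r + 1) → Fin (T + 1) := fun j =>
  ⟨⌊T * (ρ : Measure ℤ).real {z - r + j}⌋₊, Nat.lt_succ_of_le (Nat.floor_le_of_le (by
    exact mul_le_of_le_one_right (Nat.cast_nonneg T) measureReal_le_one))⟩

theorem abs_sub_le_of_windowCode_eq {r T : ℕ} (hT : 0 < T) {z : ℤ} {ρ σ : ProbabilityMeasure ℤ}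
    (h : windowCode r T z ρ = windowCode r T z σ) {x : ℤ}
    (hx : x ∈ Finset.Icc (z - r) (z + r)) :
    |(ρ : Measure ℤ).real {x} - (σ : Measure ℤ).real {x}| ≤ 1 / T := by
  rw [Finset.mem_Icc] at hx
  have hj : (x - z + r).toNat < 2 * r + 1 := by omega
  have h1 := congrArg Fin.val (congrFun h ⟨(x - z + r).toNat, hj⟩)
  have hxj : z - r + ((x - z + r).toNat : ℤ) = x := by omega
  simp only [windowCode, hxj] at h1
  have hT' : (0 : ℝ) < T := by exact_mod_cast hT
  have a1 := Nat.floor_le (mul_nonneg hT'.le (measureReal_nonneg (μ := (ρ : Measure ℤ)) (s := {x})))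
  have a2 := Nat.lt_floor_add_one (T * (ρ : Measure ℤ).real {x})
  have b1 := Nat.floor_le (mul_nonneg hT'.le (measureReal_nonneg (μ := (σ : Measure ℤ)) (s := {x})))
  have b2 := Nat.lt_floor_add_one (T * (σ : Measure ℤ).real {x})
  rw [h1] at a1 a2
  rw [abs_le, neg_le, le_div_iff₀ hT', le_div_iff₀ hT']
  constructor <;> nlinarith

open Classical in
/-- The laws concentrated on a window around one of finitely many centres have a finite net in total
variation: one representative is chosen for each centre and each code. -/
theorem exists_finset_net (Z : Finset ℤ) (r : ℕ) {T : ℕ} (hT : 0 < T) (η : ℝ) :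
    ∃ C : Finset (ProbabilityMeasure ℤ), C.card ≤ Z.card * (T + 1) ^ (2 * r + 1) ∧
      ∀ ρ : ProbabilityMeasure ℤ,
        (∃ z ∈ Z, (ρ : Measure ℤ).real ((Finset.Icc (z - r) (z + r) : Finset ℤ) : Set ℤ)ᶜ ≤ η) →
        ∃ Y ∈ C, tvDist ρ Y ≤ 1 / 2 * ((2 * r + 1) / T + 2 * η) := by
  let rep : ℤ × (Fin (2 * r + 1) → Fin (T + 1)) → ProbabilityMeasure ℤ := fun c =>
    if h : ∃ ρ : ProbabilityMeasure ℤ,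
      (ρ : Measure ℤ).real ((Finset.Icc (c.1 - r) (c.1 + r) : Finset ℤ) : Set ℤ)ᶜ ≤ η ∧
        windowCode r T c.1 ρ = c.2 then h.choose
    else ⟨Measure.dirac 0, inferInstance⟩
  refine ⟨(Z ×ˢ Finset.univ).image rep, ?_, ?_⟩
  · refine Finset.card_image_le.trans ?_
    simp [Finset.card_product]
  · rintro ρ ⟨z, hz, hρ⟩
    have hex : ∃ σ : ProbabilityMeasure ℤ,
      (σ : Measure ℤ).real ((Finset.Icc (z - r) (z + r) : Finset ℤ) : Set ℤ)ᶜ ≤ η ∧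
        windowCode r T z σ = windowCode r T z ρ := ⟨ρ, hρ, rfl⟩
    have hrep : rep (z, windowCode r T z ρ) = hex.choose := dif_pos hex
    refine ⟨rep (z, windowCode r T z ρ), Finset.mem_image_of_mem _ (by simp [hz]), ?_⟩
    rw [hrep]
    have hspec := hex.choose_spec
    refine (tvDist_le_of_window (Finset.Icc (z - r) (z + r)) (s := 1 / T)
      (fun x hx => abs_sub_le_of_windowCode_eq hT hspec.2.symm hx) hρ hspec.1).trans (le_of_eq ?_)
    have hcard : ((Finset.Icc (z - r) (z + r)).card : ℝ) = 2 * r + 1 := by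
      have : (z + r + 1 - (z - r)).toNat = 2 * r + 1 := by omega
      rw [Int.card_Icc, this]
      push_cast
      ring
    rw [hcard]
    ring

/-! ### Sums of independent variables and the structure theorem -/

theorem intCharFun_map_sum {Ω : Type*} [MeasurableSpace Ω] {P : Measure Ω}
    {n : ℕ} {ξ : Fin n → Ω → ℤ} (hm : ∀ i, Measurable (ξ i)) (hi : iIndepFun ξ P) (t : ℝ) :
    intCharFun (P.map fun ω => ∑ i, ξ i ω) t = ∏ i, intCharFun (P.map (ξ i)) t := by
  have hcast : Measurable (Int.cast : ℤ → ℝ) := by fun_prop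
  have hi' : iIndepFun (fun i ω => (ξ i ω : ℝ)) P := hi.comp (fun _ z => (z : ℝ)) fun _ => hcast
  have h := iIndepFun.charFun_map_fun_sum_eq_prod (X := fun i ω => (ξ i ω : ℝ))
    (fun i => (hcast.comp (hm i)).aemeasurable) hi'
  have hs : Measurable fun ω => ∑ i, ξ i ω := Finset.measurable_sum _ fun i _ => hm i
  have e1 : (fun ω => ∑ i, (ξ i ω : ℝ)) = Int.cast ∘ fun ω => ∑ i, ξ i ω := by
    funext ω; simp
  rw [← charFun_map_intCast, Measure.map_map hcast hs, ← e1, h, Finset.prod_apply]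
  refine Finset.prod_congr rfl fun i _ => ?_
  rw [← charFun_map_intCast, Measure.map_map hcast (hm i)]
  rfl

theorem memLp_two_intCast {Ω : Type*} [MeasurableSpace Ω] {P : Measure Ω} {Y : Ω → ℤ}
    (hY : Measurable Y) (h2 : MemLp (fun x : ℤ => (x : ℝ)) 2 (P.map Y)) :
    MemLp (fun ω => (Y ω : ℝ)) 2 P :=
  (memLp_map_measure_iff (by fun_prop) hY.aemeasurable).1 h2

theorem memLp_two_map_sum {Ω : Type*} [MeasurableSpace Ω] {P : Measure Ω}
    {n : ℕ} {ξ : Fin n → Ω → ℤ} (hm : ∀ i, Measurable (ξ i))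
    (h2 : ∀ i, MemLp (fun x : ℤ => (x : ℝ)) 2 (P.map (ξ i))) :
    MemLp (fun x : ℤ => (x : ℝ)) 2 (P.map fun ω => ∑ i, ξ i ω) := by
  have hs : Measurable fun ω => ∑ i, ξ i ω := Finset.measurable_sum _ fun i _ => hm i
  rw [memLp_map_measure_iff (by fun_prop) hs.aemeasurable]
  have h : MemLp (fun ω => ∑ i, (ξ i ω : ℝ)) 2 P :=
    memLp_finsetSum _ fun i _ => memLp_two_intCast (hm i) (h2 i)
  convert h using 1
  funext ω
  simp

theorem integral_map_sum {Ω : Type*} [MeasurableSpace Ω] {P : Measure Ω}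
    [IsProbabilityMeasure P] {n : ℕ} {ξ : Fin n → Ω → ℤ} (hm : ∀ i, Measurable (ξ i))
    (h2 : ∀ i, MemLp (fun x : ℤ => (x : ℝ)) 2 (P.map (ξ i))) :
    ∫ x : ℤ, (x : ℝ) ∂(P.map fun ω => ∑ i, ξ i ω) = ∑ i, ∫ x : ℤ, (x : ℝ) ∂(P.map (ξ i)) := by
  have hs : Measurable fun ω => ∑ i, ξ i ω := Finset.measurable_sum _ fun i _ => hm i
  rw [integral_map hs.aemeasurable (by fun_prop)]
  simp only [Int.cast_sum]
  rw [integral_finsetSum _ fun i _ =>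
    (memLp_two_intCast (hm i) (h2 i)).integrable (by norm_num)]
  refine Finset.sum_congr rfl fun i _ => ?_
  rw [integral_map (hm i).aemeasurable (by fun_prop)]

theorem variance_map_sum {Ω : Type*} [MeasurableSpace Ω] {P : Measure Ω}
    {n : ℕ} {ξ : Fin n → Ω → ℤ} (hm : ∀ i, Measurable (ξ i)) (hi : iIndepFun ξ P)
    (h2 : ∀ i, MemLp (fun x : ℤ => (x : ℝ)) 2 (P.map (ξ i))) :
    variance (fun x : ℤ => (x : ℝ)) (P.map fun ω => ∑ i, ξ i ω) =
      ∑ i, variance (fun x : ℤ => (x : ℝ)) (P.map (ξ i)) := by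
  have hs : Measurable fun ω => ∑ i, ξ i ω := Finset.measurable_sum _ fun i _ => hm i
  rw [variance_map (by fun_prop) hs.aemeasurable]
  have hi' : iIndepFun (fun i ω => (ξ i ω : ℝ)) P :=
    hi.comp (fun _ z => (z : ℝ)) fun _ => by fun_prop
  have h := IndepFun.variance_sum (μ := P) (X := fun i ω => (ξ i ω : ℝ)) (s := Finset.univ)
    (fun i _ => memLp_two_intCast (hm i) (h2 i))
    (fun i _ j _ hij => hi'.indepFun hij)
  have e1 : (∑ i, fun ω => (ξ i ω : ℝ)) = (fun x : ℤ => (x : ℝ)) ∘ fun ω => ∑ i, ξ i ω := by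
    funext ω; simp
  rw [e1] at h
  rw [h]
  refine Finset.sum_congr rfl fun i _ => ?_
  rw [variance_map (by fun_prop) (hm i).aemeasurable]
  rfl

/-- A sum of polynomially many admissible summands is close to the discretized Gaussian with the same
mean and variance. -/
theorem exists_discretizedGaussian_near {n : ℕ} {ν : Fin n → Measure ℤ}
    [∀ i, IsProbabilityMeasure (ν i)] {γ B q : ℝ} (hγ0 : 0 < γ) (hγ1 : γ < 1) (hB : 0 ≤ B)
    (hν : ∀ i, IsAdmissible (ν i) γ B) {ρ : Measure ℤ} [IsProbabilityMeasure ρ]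
    (h2 : MemLp (fun x : ℤ => (x : ℝ)) 2 ρ)
    (hρ : ∀ t, intCharFun ρ t = ∏ i, intCharFun (ν i) t)
    (hmean : ∫ x : ℤ, (x : ℝ) ∂ρ = ∑ i, ∫ y : ℤ, (y : ℝ) ∂(ν i))
    (hvar : variance (fun x : ℤ => (x : ℝ)) ρ = ∑ i, variance (fun x : ℤ => (x : ℝ)) (ν i))
    (hq2 : 2 ≤ q) (hqB : 1 + B ≤ q) (hqγ : 1 / γ ≤ q) (hn : 60000 ^ 2 * q ^ 12 ≤ n) :
    ∃ (m : ℝ) (v : ℝ≥0), 0 < v ∧ tvDist ρ (discretizedGaussian m v) ≤ 1 / q ∧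
      ∫ y : ℤ, (y : ℝ) ∂(discretizedGaussian m v) = ∫ x : ℤ, (x : ℝ) ∂ρ ∧
      variance (fun y : ℤ => (y : ℝ)) (discretizedGaussian m v) =
        variance (fun x : ℤ => (x : ℝ)) ρ := by
  have hq0 : 0 < q := by linarith
  set w := variance (fun x : ℤ => (x : ℝ)) ρ with hw
  have hw1 : n * (γ / 4) ≤ w := by
    have := Finset.card_nsmul_le_sum Finset.univ
      (fun i => variance (fun x : ℤ => (x : ℝ)) (ν i)) (γ / 4) (fun i _ => (hν i).le_variance)
    simp at this
    rw [hvar]; linarith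
  have hw2 : w ≤ n * q := by
    have := Finset.sum_le_card_nsmul Finset.univ
      (fun i => variance (fun x : ℤ => (x : ℝ)) (ν i)) q
      (fun i _ => (variance_le_one_add (hν i).memLp_four (hν i).centralMoment_four_le).trans hqB)
    simp at this
    rw [hvar]; linarith
  have hqγ' : 1 ≤ q * γ := by rwa [div_le_iff₀ hγ0] at hqγ
  -- the square root of the number of summands, in terms of which the error is measured
  set x := √(n : ℝ) with hx
  have hxn : x ^ 2 = n := Real.sq_sqrt (Nat.cast_nonneg n)
  have hxq : 60000 * q ^ 6 ≤ x := by
    refine Real.le_sqrt_of_sq_le ?_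
    have e : (60000 * q ^ 6) ^ 2 = 60000 ^ 2 * q ^ 12 := by ring
    rwa [e]
  have hx0 : 0 < x := lt_of_lt_of_le (by positivity) hxq
  have hq1 : 1 ≤ q := by linarith
  have hw4 : 4 ≤ w := by
    have h1 : (16 : ℝ) * q ≤ n := by
      have : q ≤ q ^ 12 := le_self_pow₀ hq1 (by norm_num)
      linarith
    nlinarith
  obtain ⟨m, v, hv0, hm, hvw, hv4, hY2, hYm, hYv⟩ :=
    exists_discretizedGaussian_mean_variance_eq (∫ x : ℤ, (x : ℝ) ∂ρ) hw4
  refine ⟨m, v, hv0, ?_, hYm, hYv⟩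
  have hn0 : 0 < n := by
    have : (0 : ℝ) < n := by rw [← hxn]; positivity
    exact_mod_cast this
  have hloc := local_limit_discretizedGaussian hγ0 hγ1 hB hν hn0 hρ hmean hvar hv0 hm hvw hv4
  refine (tvDist_le_of_mean_variance_eq h2 hY2 hYm hYv (r := 2 * q * x) (by positivity)
    hloc).trans ?_
  have hs : 12000 * (1 + B) ^ 2 / (n * γ ^ 2) ≤ 12000 * q ^ 4 / x ^ 2 := by
    rw [hxn, div_le_div_iff₀ (by positivity) (by positivity)]
    have h1 : (1 + B) ^ 2 ≤ q ^ 4 * γ ^ 2 := by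
      calc (1 + B) ^ 2 ≤ q ^ 2 * 1 := by rw [mul_one]; gcongr
        _ ≤ q ^ 2 * (q * γ) ^ 2 := by gcongr; exact one_le_pow₀ hqγ'
        _ = q ^ 4 * γ ^ 2 := by ring
    nlinarith [Nat.cast_nonneg (α := ℝ) n]
  have hA : (2 * q * x + 1 / 2) * (12000 * (1 + B) ^ 2 / (n * γ ^ 2)) ≤ 3 / 5 * (1 / q) := by
    have h1 : 2 * q * x + 1 / 2 ≤ 3 * q * x := by
      have : 1 ≤ q * x := by nlinarith [one_le_pow₀ hq1 (n := 6)]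
      linarith
    calc _ ≤ 3 * q * x * (12000 * q ^ 4 / x ^ 2) := by gcongr
      _ = 36000 * q ^ 5 / x := by field_simp; norm_num
      _ ≤ 3 / 5 * (1 / q) := by
        rw [div_le_iff₀ hx0, mul_one_div, div_mul_eq_mul_div, le_div_iff₀ hq0]
        nlinarith
  have hC : w / (2 * q * x) ^ 2 ≤ 1 / 4 * (1 / q) := by
    rw [mul_pow, hxn, mul_one_div, div_le_div_iff₀ (by positivity) hq0]
    have : w * q ≤ n * q * q := by gcongr
    nlinarith
  have : 0 < 1 / q := by positivity
  linarith

theorem IsAdmissible.exists_isMode_near_mean {ν : Measure ℤ} [IsProbabilityMeasure ν] {γ B q : ℝ}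
    (h : IsAdmissible ν γ B) (hB : 0 ≤ B) (hq : 1 + B ≤ q) :
    ∃ M : ℤ, IsMode ν M ∧ |(M : ℝ) - ∫ x : ℤ, (x : ℝ) ∂ν| ≤ 7 * q := by
  have hv := variance_le_one_add h.memLp_four h.centralMoment_four_le
  obtain ⟨M, hM, hle⟩ := h.unimodal.exists_isMode_near_mean
    (h.memLp_four.mono_exponent (by norm_num)) (r := 2 * (1 + B)) (by positivity) (by nlinarith)
  exact ⟨M, hM, by linarith⟩

/-- The integers that can be the integer part of the mean of a sum of fewer than `K` independent
variables with means in `[b₁, b₂]`. -/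
noncomputable def meanCentres (K : ℕ) (b₁ b₂ : ℝ) : Finset ℤ :=
  (Finset.range K).biUnion fun j => Finset.Icc ⌊j * b₁⌋ ⌊j * b₂⌋

theorem card_meanCentres_le (K : ℕ) {b₁ b₂ : ℝ} (hb : b₁ ≤ b₂) :
    ((meanCentres K b₁ b₂).card : ℝ) ≤ K * (K * (b₂ - b₁) + 2) := by
  have h1 : ((meanCentres K b₁ b₂).card : ℝ) ≤
      ∑ j ∈ Finset.range K, ((Finset.Icc ⌊j * b₁⌋ ⌊j * b₂⌋).card : ℝ) := by
    exact_mod_cast Finset.card_biUnion_le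
  refine h1.trans ((Finset.sum_le_card_nsmul _ _ (K * (b₂ - b₁) + 2) fun j hj => ?_).trans ?_)
  · have hjK : (j : ℝ) ≤ K := by exact_mod_cast (Finset.mem_range.1 hj).le
    have h2 := mul_le_mul_of_nonneg_right hjK (sub_nonneg.2 hb)
    have h3 : 0 ≤ (K : ℝ) * (b₂ - b₁) := mul_nonneg (Nat.cast_nonneg K) (sub_nonneg.2 hb)
    exact card_Icc_floor_le (Int.sub_one_lt_floor _).le (Int.floor_le _) (by linarith)
      (by linarith)
  · rw [Finset.card_range, nsmul_eq_mul]

theorem floor_mem_meanCentres {K j : ℕ} (hj : j < K) {b₁ b₂ μ : ℝ} (h1 : j * b₁ ≤ μ)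
    (h2 : μ ≤ j * b₂) : ⌊μ⌋ ∈ meanCentres K b₁ b₂ :=
  Finset.mem_biUnion.2 ⟨j, Finset.mem_range.2 hj,
    Finset.mem_Icc.2 ⟨Int.floor_mono h1, Int.floor_mono h2⟩⟩

theorem measureReal_compl_Icc_floor_mean_le {ρ : Measure ℤ} [IsProbabilityMeasure ρ]
    (h2 : MemLp (fun x : ℤ => (x : ℝ)) 2 ρ) {r : ℕ} (hr : 0 < r) :
    ρ.real ((Finset.Icc (⌊∫ x : ℤ, (x : ℝ) ∂ρ⌋ - r) (⌊∫ x : ℤ, (x : ℝ) ∂ρ⌋ + r) : Finset ℤ) :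
      Set ℤ)ᶜ ≤ variance (fun x : ℤ => (x : ℝ)) ρ / r ^ 2 := by
  refine le_trans (measureReal_mono (Set.compl_subset_compl.2 ?_))
    (measureReal_compl_intWindow_le h2 (r := r) (by exact_mod_cast hr))
  intro x hx
  rw [Finset.mem_coe, mem_intWindow, abs_le] at hx
  set μ := ∫ x : ℤ, (x : ℝ) ∂ρ
  have h1 := Int.floor_le μ
  have h3 := Int.lt_floor_add_one μ
  rw [Finset.mem_coe, Finset.mem_Icc]
  constructor
  · have : ((⌊μ⌋ - r : ℤ) : ℝ) ≤ x := by push_cast; linarith [hx.1]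
    exact_mod_cast this
  · have : (x : ℝ) < ((⌊μ⌋ + r + 1 : ℤ) : ℝ) := by push_cast; linarith [hx.2]
    exact Int.lt_add_one_iff.1 (by exact_mod_cast this)

/-- The factors of the size of the net other than the linear one in `Λ` are absorbed by `x ≤ 2 ^ x`. -/
theorem card_net_le {Λ : ℝ} (hΛ : 2 ≤ Λ) {c z a T N : ℕ} (hc : c ≤ z * (T + 1) ^ N)
    (hz : (z : ℝ) ≤ Λ * a) : (c : ℝ) ≤ Λ ^ (1 + a + T * N) := by
  have hΛ0 : 0 ≤ Λ := by linarith
  have ha : (a : ℝ) ≤ Λ ^ a := by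
    have : (a : ℝ) ≤ 2 ^ a := by exact_mod_cast Nat.lt_two_pow_self.le
    exact this.trans (pow_le_pow_left₀ (by norm_num) hΛ a)
  have hT : ((T : ℝ) + 1) ≤ Λ ^ T := by
    have : ((T : ℝ) + 1) ≤ 2 ^ T := by exact_mod_cast Nat.succ_le_of_lt (Nat.lt_two_pow_self (n := T))
    exact this.trans (pow_le_pow_left₀ (by norm_num) hΛ T)
  calc (c : ℝ) ≤ z * ((T : ℝ) + 1) ^ N := by exact_mod_cast hc
    _ ≤ (Λ * Λ ^ a) * (Λ ^ T) ^ N := by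
      refine mul_le_mul (hz.trans (by gcongr)) (by gcongr) (by positivity) (by positivity)
    _ = Λ ^ (1 + a + T * N) := by rw [← pow_mul, ← pow_succ', ← pow_add]; ring_nf

/-- The exponent of the size of the sparse part, as a function of `u`, an upper bound for the
parameters. -/
def sparseExponent {R : Type*} [CommSemiring R] (u : R) : R :=
  1 + 17 * (60000 ^ 2 * u ^ 12) ^ 2 * u + (4 * (60000 ^ 2 * u ^ 12) * u ^ 2 + 1) ^ 2 * u

/-- The sums of fewer than `60000² q¹²` members of the family have a net of the required size. -/
theorem exists_sparse_net (q : ℕ) (hq : 2 ≤ q) {γ L B : ℝ} (hL : 0 < L) (hB : 0 < B)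
    (hqB : 1 + B ≤ q) {D : Set (ProbabilityMeasure ℤ)} (hD : UnimodalBoundedFamily D γ L B) :
    ∃ C : Finset (ProbabilityMeasure ℤ),
      (C.card : ℝ) ≤ (max L 2) ^ sparseExponent q ∧
      ∀ n < 60000 ^ 2 * q ^ 12, ∀ ν : Fin n → ProbabilityMeasure ℤ, (∀ i, ν i ∈ D) →
        ∀ ρ : ProbabilityMeasure ℤ, MemLp (fun x : ℤ => (x : ℝ)) 2 (ρ : Measure ℤ) →
        ∫ x : ℤ, (x : ℝ) ∂(ρ : Measure ℤ) = ∑ i, ∫ y : ℤ, (y : ℝ) ∂(ν i : Measure ℤ) →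
        variance (fun x : ℤ => (x : ℝ)) (ρ : Measure ℤ) =
          ∑ i, variance (fun x : ℤ => (x : ℝ)) (ν i : Measure ℤ) →
        ∃ Y ∈ C, tvDist ρ Y ≤ 1 / q := by
  have hq' : (2 : ℝ) ≤ q := by exact_mod_cast hq
  set K : ℕ := 60000 ^ 2 * q ^ 12 with hK
  have hK0 : 0 < K := by positivity
  have hK1 : (1 : ℝ) ≤ K := by exact_mod_cast hK0
  set r : ℕ := 2 * K * q ^ 2 with hr
  have hr0 : 0 < r := by positivity
  obtain ⟨a, ha⟩ := hD.mode_mem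
  set Λ := max L 2 with hΛ
  have hΛ2 : 2 ≤ Λ := le_max_right _ _
  have hΛL : L ≤ Λ := le_max_left _ _
  obtain ⟨C, hC, hnet⟩ := exists_finset_net (meanCentres K (a - 7 * q) (a + L + 7 * q)) r
    (T := (2 * r + 1) * q) (by positivity) (1 / (2 * q))
  refine ⟨C, ?_, ?_⟩
  · have hz : ((meanCentres K (a - 7 * q) (a + L + 7 * q)).card : ℝ) ≤
        Λ * ((17 * K ^ 2 * q : ℕ) : ℝ) := by
      refine (card_meanCentres_le K (by linarith)).trans ?_
      have h1 : a + L + 7 * q - (a - 7 * q) ≤ 15 * q * Λ := by nlinarith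
      have h2 : (2 : ℝ) ≤ 2 * K * q * Λ := by
        have : 1 ≤ (K : ℝ) * q := by nlinarith
        nlinarith
      calc (K : ℝ) * (K * (a + L + 7 * q - (a - 7 * q)) + 2)
          ≤ K * (K * (15 * q * Λ) + 2 * K * q * Λ) := by gcongr
        _ = Λ * ((17 * K ^ 2 * q : ℕ) : ℝ) := by push_cast; ring
    refine (card_net_le hΛ2 hC hz).trans (le_of_eq ?_)
    congr 1
    rw [sparseExponent, ← hK, hr]
    ring
  · intro n hn ν hν ρ h2 hmean hvar
    have hadm : ∀ i, IsAdmissible (ν i : Measure ℤ) γ B := fun i =>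
      ⟨hD.unimodal _ (hν i), hD.mode_mass_le _ (hν i), hD.memLp_four _ (hν i),
        hD.centralMoment_four_le _ (hν i)⟩
    have hmi : ∀ i, a - 7 * q ≤ ∫ y : ℤ, (y : ℝ) ∂(ν i : Measure ℤ) ∧
        ∫ y : ℤ, (y : ℝ) ∂(ν i : Measure ℤ) ≤ a + L + 7 * q := by
      intro i
      obtain ⟨M, hM, hle⟩ := (hadm i).exists_isMode_near_mean hB.le hqB
      have := ha _ (hν i) M hM
      rw [abs_le] at hle
      constructor <;> linarith [this.1, this.2, hle.1, hle.2]
    suffices h : ⌊∫ x : ℤ, (x : ℝ) ∂(ρ : Measure ℤ)⌋ ∈ meanCentres K (a - 7 * q) (a + L + 7 * q) ∧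
        (ρ : Measure ℤ).real ((Finset.Icc (⌊∫ x : ℤ, (x : ℝ) ∂(ρ : Measure ℤ)⌋ - r)
          (⌊∫ x : ℤ, (x : ℝ) ∂(ρ : Measure ℤ)⌋ + r) : Finset ℤ) : Set ℤ)ᶜ ≤ 1 / (2 * q) by
      obtain ⟨Y, hY, htv⟩ := hnet ρ ⟨_, h⟩
      refine ⟨Y, hY, htv.trans (le_of_eq ?_)⟩
      push_cast
      field_simp
      norm_num
    constructor
    · refine floor_mem_meanCentres hn ?_ ?_ <;> rw [hmean]
      · have := Finset.card_nsmul_le_sum Finset.univ _ _ fun i _ => (hmi i).1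
        simpa using this
      · have := Finset.sum_le_card_nsmul Finset.univ _ _ fun i _ => (hmi i).2
        simpa only [Finset.card_univ, Fintype.card_fin, nsmul_eq_mul] using this
    · refine (measureReal_compl_Icc_floor_mean_le h2 hr0).trans ?_
      have hw : variance (fun x : ℤ => (x : ℝ)) (ρ : Measure ℤ) ≤ K * q := by
        have := Finset.sum_le_card_nsmul Finset.univ
          (fun i => variance (fun x : ℤ => (x : ℝ)) (ν i : Measure ℤ)) (q : ℝ) (fun i _ =>
            (variance_le_one_add (hadm i).memLp_four (hadm i).centralMoment_four_le).trans hqB)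
        rw [hvar]
        refine this.trans ?_
        have hnK : (n : ℝ) ≤ K := by exact_mod_cast hn.le
        simp only [Finset.card_univ, Fintype.card_fin, nsmul_eq_mul]
        gcongr
      have hr' : (r : ℝ) = 2 * K * q ^ 2 := by rw [hr]; push_cast; ring
      have hr1 : 0 < (r : ℝ) := by exact_mod_cast hr0
      rw [div_le_div_iff₀ (by positivity) (by positivity), hr']
      have h3 : (1 : ℝ) ≤ K * q ^ 2 := by nlinarith
      have h4 : (K : ℝ) * q * (2 * q) ≤ (K * q ^ 2) * (2 * (K * q ^ 2)) := by
        nlinarith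
      nlinarith

theorem sparseExponent_mono {s t : ℝ} (hs : 0 ≤ s) (hst : s ≤ t) :
    sparseExponent s ≤ sparseExponent t := by
  unfold sparseExponent
  gcongr

theorem theorem2p2 :
    ∃ p : MvPolynomial (Fin 3) ℝ,
      ∀ (n : ℕ) (γ L B : ℝ), 0 < γ → γ < 1 → 0 < L → 0 < B →
      ∀ D : Set (ProbabilityMeasure ℤ), UnimodalBoundedFamily D γ L B →
      ∀ ε : ℝ, 0 < ε →
      ∃ C : Finset (ProbabilityMeasure ℤ),
        (C.card : ℝ) ≤ (max L 2) ^ (MvPolynomial.eval ![B, 1 / γ, 1 / ε] p) ∧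
        ∀ (Ω : Type*) [MeasurableSpace Ω] (P : Measure Ω) [IsProbabilityMeasure P] (X : Ω → ℤ),
          IsSIIRV D n P X →
          ∃ Y : ProbabilityMeasure ℤ,
            tvDist (P.map X) Y ≤ ε ∧
            (Y ∈ C ∨
              ((∃ (m : ℝ) (v : ℝ≥0), 0 < v ∧ (Y : Measure ℤ) = discretizedGaussian m v) ∧
                ∫ y : ℤ, (y : ℝ) ∂(Y : Measure ℤ) = ∫ ω, (X ω : ℝ) ∂P ∧
                variance (fun y : ℤ => (y : ℝ)) (Y : Measure ℤ) =
                  variance (fun ω => (X ω : ℝ)) P)) := by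
  refine ⟨sparseExponent (3 + MvPolynomial.X 0 + MvPolynomial.X 1 + MvPolynomial.X 2), ?_⟩
  intro n γ L B hγ0 hγ1 hL hB D hD ε hε
  have hγi : 0 < 1 / γ := by positivity
  have hεi : 0 < 1 / ε := by positivity
  obtain ⟨q, hq1, hq2⟩ : ∃ q : ℕ, 2 + B + 1 / γ + 1 / ε ≤ q ∧ q ≤ 3 + B + 1 / γ + 1 / ε :=
    ⟨⌈2 + B + 1 / γ + 1 / ε⌉₊, Nat.le_ceil _,
      (Nat.ceil_lt_add_one (by positivity)).le.trans (by linarith)⟩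
  have hq : 2 ≤ q := by
    have : (2 : ℝ) ≤ q := by linarith
    exact_mod_cast this
  have hqε : 1 / (q : ℝ) ≤ ε := by
    rw [one_div_le (by linarith) hε]
    linarith
  obtain ⟨C, hC, hsparse⟩ := exists_sparse_net q hq hL hB (by linarith) hD
  refine ⟨C, hC.trans ?_, ?_⟩
  · rw [← Real.rpow_natCast]
    refine Real.rpow_le_rpow_of_exponent_le (by linarith [le_max_right L 2]) ?_
    have e1 : ((sparseExponent q : ℕ) : ℝ) = sparseExponent (q : ℝ) := by
      simp only [sparseExponent]; push_cast; ring
    have e2 : MvPolynomial.eval ![B, 1 / γ, 1 / ε]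
        (sparseExponent (3 + MvPolynomial.X 0 + MvPolynomial.X 1 + MvPolynomial.X 2)) =
        sparseExponent (3 + B + 1 / γ + 1 / ε) := by
      simp [sparseExponent]
    rw [e1, e2]
    exact sparseExponent_mono (Nat.cast_nonneg q) hq2
  · rintro Ω _ P _ X ⟨n', -, ξ, hm, hi, hlaw, hX⟩
    obtain rfl : X = fun ω => ∑ i, ξ i ω := funext hX
    have hXm : Measurable fun ω => ∑ i, ξ i ω := Finset.measurable_sum _ fun i _ => hm i
    choose ν hνD hν using hlaw
    have h2 : ∀ i, MemLp (fun x : ℤ => (x : ℝ)) 2 (P.map (ξ i)) := fun i => by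
      rw [hν i]
      exact (hD.memLp_four _ (hνD i)).mono_exponent (by norm_num)
    have hmem := memLp_two_map_sum hm h2
    have hmean := integral_map_sum hm h2
    have hvar := variance_map_sum hm hi h2
    have hchar := intCharFun_map_sum hm hi
    simp_rw [hν] at hmean hvar hchar
    have hprob : IsProbabilityMeasure (P.map fun ω => ∑ i, ξ i ω) :=
      Measure.isProbabilityMeasure_map hXm.aemeasurable
    rcases lt_or_ge n' (60000 ^ 2 * q ^ 12) with hn | hn
    · obtain ⟨Y, hY, htv⟩ := hsparse n' hn ν hνD ⟨_, hprob⟩ hmem hmean hvar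
      exact ⟨Y, htv.trans hqε, Or.inl hY⟩
    · obtain ⟨m, v, hv0, htv, hYm, hYv⟩ := exists_discretizedGaussian_near (q := q) hγ0 hγ1 hB.le
        (ν := fun i => (ν i : Measure ℤ))
        (fun i => ⟨hD.unimodal _ (hνD i), hD.mode_mass_le _ (hνD i), hD.memLp_four _ (hνD i),
          hD.centralMoment_four_le _ (hνD i)⟩) hmem hchar hmean hvar
        (by exact_mod_cast hq) (by linarith) (by linarith) (by exact_mod_cast hn)
      refine ⟨⟨discretizedGaussian m v, inferInstance⟩, htv.trans hqε,
        Or.inr ⟨⟨m, v, hv0, rfl⟩, hYm.trans ?_, hYv.trans ?_⟩⟩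
      · rw [integral_map hXm.aemeasurable (by fun_prop)]
      · rw [variance_map (by fun_prop) hXm.aemeasurable]
        rfl
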